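/- Let $\lambda>0$. A $C^\infty$ function $\psi:(0,\infty)\to\mathbb R$ is completely monotonic (CM) if $(-1)^n\psi^{(n)}(x)\ge 0$ for all integers $n\ge 0$ and all $x>0$. Write $\gamma(\lambda,x)=\int_0^x u^{\lambda-1}e^{-u}\,du$ and $B(p,q,x)=\int_0^x t^{p-1}(1-t)^{q-1}\,dt$ ($p>0$, $q\in\mathbb R$, $0\le x<1$). For $\rho>0$, $\mathcal S_\rho$ (generalized Stieltjes functions of order $\rho$) is the class of functions on $(0,\infty)$ of the form $c+\int_{[0,\infty)}\frac{d\mu(t)}{(t+x)^{\rho}}$ with $c\ge 0$ and $\mu$ a positive measure on $[0,\infty)$ with $\int_{[0,\infty)}\frac{d\mu(t)}{(1+t)^{\rho}}<\infty$. For $\alpha<\lambda+1$, $\mathcal T_{\lambda,\alpha}$ ($(\lambda,\alpha)$-Thorin–Bernstein functions) is the class of functions on $(0,\infty)$ of the form $f(x)=ax^\lambda+b+\int_0^\infty\gamma(\lambda,xt)\varphi(t)\,dt$, where $a,b\ge 0$, $t^\alpha\varphi(t)$ is CM and the integral converges for all $x>0$. $\mathcal B_\lambda$ (generalized Bernstein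 functions of order $\lambda$) is the class of $C^\infty$ functions $g:(0,\infty)\to[0,\infty)$ such that $x^{1-\lambda}g'(x)$ is CM. (i) Let $\alpha<\lambda+1$ and $f:(0,\infty)\to[0,\infty)$. Then $f\in\mathcal T_{\lambda,\alpha}$ if and only if $f$ is differentiable on $(0,\infty)$ and the function $x\mapsto x^{1-\lambda}f'(x)$ belongs to $\mathcal S_{\lambda+1-\alpha}$. (ii) Let $f\in\mathcal B_\lambda$. Then $f$ corresponds to some triple $(a,b,\mu)$, that is, there are $a,b\ge 0$ and a positive measure $\mu$ on $(0,\infty)$ with $\int_{(0,\infty)}\frac{d\mu(t)}{(t+1)^{\lambda}}<\infty$ such that $f(x)=ax^\lambda+b+\int_{(0,\infty)}\gamma(\lambda,xt)\,\frac{d\mu(t)}{t^\lambda}$ for all $x>0$. For every such triple, the functions $$f_n(x)=ax^\lambda+b+\frac{\Gamma(\lambda+n)}{\Gamma(n)}\int_{(0,\infty)}B\Big(\lambda,n,\frac{x}{x+n/t}\Big)\frac{d\mu(t)}{t^\lambda}\qquad(n\ge 1,\ x>0)$$ are given by convergent integrals, each $f_n$ belongs to $\bigcup_{\alpha<\lambda+1}\mathcal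 T_{\lambda,\alpha}$, and $f_n(x)\to f(x)$ as $n\to\infty$ for every $x>0$. -/

import Mathlib

open Set Filter Topology MeasureTheory
open scoped ContDiff

noncomputable section

/-- A `C^∞` function `f` on `(0,∞)` is completely monotonic if `(-1)^n f^{(n)}(x) ≥ 0` for all
`n ≥ 0` and `x > 0`. As everywhere below, only the values of `f` on `(0,∞)` matter. -/
def CompletelyMonotonic (f : ℝ → ℝ) : Prop :=
  ContDiffOn ℝ ∞ f (Ioi 0) ∧
    ∀ n : ℕ, ∀ x : ℝ, 0 < x → 0 ≤ (-1 : ℝ) ^ n * iteratedDerivWithin n f (Ioi 0) x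

/-- The class `CM(α)`: `t^α φ(t)` is completely monotonic. -/
def CompletelyMonotonicOfOrder (α : ℝ) (φ : ℝ → ℝ) : Prop :=
  CompletelyMonotonic (fun t => t ^ α * φ t)

/-- The incomplete Gamma function `γ(s,x) = ∫_0^x u^{s-1} e^{-u} du`, for `s > 0` and `x > 0`. -/
def incompleteGamma (s x : ℝ) : ℝ :=
  ∫ u in (0 : ℝ)..x, u ^ (s - 1) * Real.exp (-u)

/-- The incomplete Beta function `B(p,q,x) = ∫_0^x t^{p-1} (1-t)^{q-1} dt`, for `p > 0`,
real `q` and `0 ≤ x < 1`. -/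
def incompleteBeta (p q x : ℝ) : ℝ :=
  ∫ t in (0 : ℝ)..x, t ^ (p - 1) * (1 - t) ^ (q - 1)

/-- The class `S_ρ` (for `ρ > 0`) of generalized Stieltjes functions of order `ρ`. Only the
restriction of `μ` to `[0,∞)` matters. -/
def IsGenStieltjes (ρ : ℝ) (f : ℝ → ℝ) : Prop :=
  ∃ (c : ℝ) (μ : Measure ℝ), 0 ≤ c ∧
    IntegrableOn (fun t => 1 / (1 + t) ^ ρ) (Ici 0) μ ∧
    ∀ x : ℝ, 0 < x → f x = c + ∫ t in Ici 0, 1 / (t + x) ^ ρ ∂μ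

/-- The class `T_{lam,α}` (for `lam > 0` and `α < lam + 1`) of
`(lam,α)`-Thorin-Bernstein functions. -/
def IsThorinBernstein (lam α : ℝ) (f : ℝ → ℝ) : Prop :=
  ∃ (a b : ℝ) (φ : ℝ → ℝ), 0 ≤ a ∧ 0 ≤ b ∧ CompletelyMonotonicOfOrder α φ ∧
    ∀ x : ℝ, 0 < x →
      IntegrableOn (fun t => incompleteGamma lam (x * t) * φ t) (Ioi 0) ∧
      f x = a * x ^ lam + b + ∫ t in Ioi 0, incompleteGamma lam (x * t) * φ t

/-- The class `B_lam` (for `lam > 0`) of generalized Bernstein functions of order `lam`. -/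
def IsGenBernstein (lam : ℝ) (g : ℝ → ℝ) : Prop :=
  (∀ x : ℝ, 0 < x → 0 ≤ g x) ∧ ContDiffOn ℝ ∞ g (Ioi 0) ∧
    CompletelyMonotonic (fun x => deriv g x * x ^ (1 - lam))

/-- `f` corresponds to the triple `(a,b,μ)`: here `a, b ≥ 0`, `μ` is a positive measure on `(0,∞)`
with `∫ dμ(t)/(t+1)^lam < ∞`, and `f(x) = a x^lam + b + ∫ γ(lam,xt) t^{-lam} dμ(t)`. Only the
restriction of `μ` to `(0,∞)` matters. -/
def CorrespondsToTriple (lam a b : ℝ) (μ : Measure ℝ) (f : ℝ → ℝ) : Prop :=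
  0 ≤ a ∧ 0 ≤ b ∧ IntegrableOn (fun t => 1 / (t + 1) ^ lam) (Ioi 0) μ ∧
    ∀ x : ℝ, 0 < x →
      f x = a * x ^ lam + b + ∫ t in Ioi 0, incompleteGamma lam (x * t) / t ^ lam ∂μ

/-- The integrand of the `n`-th approximant, `n ≥ 1`. -/
def betaIntegrand (lam : ℝ) (n : ℕ) (x t : ℝ) : ℝ :=
  incompleteBeta lam n (x / (x + n / t)) / t ^ lam

/-- The `n`-th approximant (`n ≥ 1`) built from a triple `(a,b,μ)`. -/
def betaApprox (lam a b : ℝ) (μ : Measure ℝ) (n : ℕ) (x : ℝ) : ℝ :=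
  a * x ^ lam + b +
    Real.Gamma (lam + n) / Real.Gamma n * ∫ t in Ioi 0, betaIntegrand lam n x t ∂μ

end

/-! ### Taylor expansions of completely monotonic functions. -/

noncomputable section

/-! Everything is read off the normalised derivative `x^(1-lam) f'(x)`. If `k` is a decreasing
kernel with weighted primitive `W(y) = ∫_0^y u^(lam-1) k(u) du`, then the substitution `u = yt` and
Tonelli turn `∫ W(xt) t^(-lam) dκ(t)` into `∫_0^x y^(lam-1) (∫ k(yt) dκ(t)) dy`, whose normalised
derivative is `∫ k(xt) dκ(t)`. Conversely, a nonnegative `f` with such a normalised derivative, up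
to a constant `c ≥ 0`, is recovered by integrating from its limit `b` at `0`
(`IsDecayKernel.exists_eq_add_integral`).

With `k(u) = e^(-u)`, `W` is the incomplete Gamma function. Bernstein's theorem, proved here from
Taylor expansions and weak compactness, writes `t^α φ(t)` as a Laplace transform of some `ν`; then
`∫ t^(lam-α) e^(-(s+x)t) dt = Γ(lam+1-α) (s+x)^(-(lam+1-α))` converts between `φ` and a Stieltjes
measure, in both directions. This is (i). Bernstein's theorem applied to the normalised derivative
itself gives the triple in (ii).

With `k(u) = (1+u/n)^(-(n+lam))`, `W` is a rescaled incomplete Beta function. This kernel is a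
Stieltjes kernel of order `n+lam` in `x`, so (i) makes `f_n` Thorin-Bernstein with `α = 1-n`. It
tends to `e^(-u)`, and a bound uniform in `n` allows dominated convergence. -/

/-- A sequence `g` of nonnegative functions on `(0,∞)` with `g n ' = - g (n+1)`. -/
def IsCMSequence (g : ℕ → ℝ → ℝ) : Prop :=
  ∀ n x, 0 < x → 0 ≤ g n x ∧ HasDerivAt (g n) (-(g (n + 1) x)) x

theorem CompletelyMonotonic.isCMSequence {f : ℝ → ℝ} (hf : CompletelyMonotonic f) :
    IsCMSequence (fun n x => (-1 : ℝ) ^ n * iteratedDerivWithin n f (Ioi 0) x) := by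
  intro n x hx
  refine ⟨hf.2 n x hx, ?_⟩
  have h1 : DifferentiableOn ℝ (iteratedDerivWithin n f (Ioi 0)) (Ioi 0) :=
    hf.1.differentiableOn_iteratedDerivWithin (by exact_mod_cast WithTop.coe_lt_top _)
      (uniqueDiffOn_Ioi 0)
  have h2 : HasDerivAt (iteratedDerivWithin n f (Ioi 0))
      (iteratedDerivWithin (n + 1) f (Ioi 0) x) x := by
    rw [iteratedDerivWithin_succ]
    exact ((h1 x hx).hasDerivWithinAt).hasDerivAt (Ioi_mem_nhds hx)
  refine (h2.const_mul ((-1 : ℝ) ^ n)).congr_deriv ?_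
  simp only [pow_succ]
  ring

namespace IsCMSequence

variable {g : ℕ → ℝ → ℝ}

theorem nonneg (hg : IsCMSequence g) (n : ℕ) {x : ℝ} (hx : 0 < x) : 0 ≤ g n x := (hg n x hx).1

theorem hasDerivAt (hg : IsCMSequence g) (n : ℕ) {x : ℝ} (hx : 0 < x) :
    HasDerivAt (g n) (-(g (n + 1) x)) x := (hg n x hx).2

theorem continuousOn (hg : IsCMSequence g) (n : ℕ) : ContinuousOn (g n) (Ioi 0) :=
  fun _ hx => (hg.hasDerivAt n hx).continuousAt.continuousWithinAt

/-- The product rule telescopes: each term cancels half of the derivative of the next, and only the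
top derivative survives. -/
theorem hasDerivAt_taylor (hg : IsCMSequence g) (x : ℝ) (n : ℕ) {t : ℝ} (ht : 0 < t) :
    HasDerivAt (fun t => ∑ k ∈ Finset.range (n + 1), g k t * ((t - x) ^ k / k.factorial))
      (-(g (n + 1) t * ((t - x) ^ n / n.factorial))) t := by
  induction n with
  | zero => simpa using hg.hasDerivAt 0 ht
  | succ n ih =>
    simp_rw [Finset.sum_range_succ _ (n + 1)]
    have h1 : HasDerivAt (fun t : ℝ => (t - x) ^ (n + 1) / ((n + 1).factorial : ℝ))
        ((t - x) ^ n / n.factorial) t := by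
      have := (((hasDerivAt_id t).sub_const x).pow (n + 1)).div_const ((n + 1).factorial : ℝ)
      refine this.congr_deriv ?_
      have : (n.factorial : ℝ) ≠ 0 := by positivity
      simp only [Nat.factorial_succ]
      push_cast
      simp
      field_simp
    refine (ih.add ((hg.hasDerivAt (n + 1) ht).mul h1)).congr_deriv ?_
    ring

theorem taylor_remainder (hg : IsCMSequence g) {x R : ℝ} (hx : 0 < x) (hxR : x ≤ R) (n : ℕ) :
    IntervalIntegrable (fun t => g (n + 1) t * ((t - x) ^ n / n.factorial)) volume x R ∧
    g 0 x - ∑ k ∈ Finset.range (n + 1), g k R * ((R - x) ^ k / k.factorial) =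
      ∫ t in x..R, g (n + 1) t * ((t - x) ^ n / n.factorial) := by
  have hsub : uIcc x R ⊆ Ioi 0 := by
    rw [uIcc_of_le hxR]; intro t ht; exact hx.trans_le ht.1
  have hint : IntervalIntegrable (fun t => g (n + 1) t * ((t - x) ^ n / n.factorial)) volume x R :=
    (((hg.continuousOn (n + 1)).mono hsub).mul (by fun_prop)).intervalIntegrable
  refine ⟨hint, ?_⟩
  have h := intervalIntegral.integral_eq_sub_of_hasDerivAt
    (fun t ht => hg.hasDerivAt_taylor x n (hsub ht)) hint.neg
  rw [intervalIntegral.integral_neg] at h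
  have h0 : ∑ k ∈ Finset.range (n + 1), g k x * ((x - x) ^ k / k.factorial) = g 0 x := by
    rw [Finset.sum_range_succ']
    simp
  rw [h0] at h
  linarith

/-- The remainder is nonnegative, and comparing it with the remainder at a point further to the left
shows that it decays geometrically. -/
theorem hasSum_taylor (hg : IsCMSequence g) {x R : ℝ} (hx : 0 < x) (hxR : x < R) :
    HasSum (fun k => g k R * ((R - x) ^ k / k.factorial)) (g 0 x) := by
  have hR : 0 < R := hx.trans hxR
  rw [hasSum_iff_tendsto_nat_of_nonneg
    (fun k => mul_nonneg (hg.nonneg k hR) (by have := sub_pos.2 hxR; positivity))]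
  rw [← tendsto_add_atTop_iff_nat 1]
  -- Any point of `(0, x)` would do. Since `(t-x)/(t-y)` increases with `t`, it is at most `q < 1`
  -- on `[x, R]`; so the remainder at `x` is at most `q^n` times that at `y`, which is at most `g 0
  -- y`.
  set y := x / 2 with hy
  have hy0 : 0 < y := by positivity
  have hyx : y < x := by simp only [hy]; linarith
  set q := (R - x) / (R - y) with hq
  have hq0 : 0 ≤ q := div_nonneg (by linarith) (by linarith)
  have hq1 : q < 1 := by rw [hq, div_lt_one (by linarith)]; linarith
  have key : ∀ n : ℕ,
      g 0 x - ∑ k ∈ Finset.range (n + 1), g k R * ((R - x) ^ k / k.factorial) ≤ q ^ n * g 0 y := by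
    intro n
    obtain ⟨i1, e1⟩ := hg.taylor_remainder hx hxR.le n
    obtain ⟨i2, e2⟩ := hg.taylor_remainder hy0 (hyx.le.trans hxR.le) n
    have i3 : IntervalIntegrable (fun t => g (n + 1) t * ((t - y) ^ n / n.factorial)) volume x R :=
      i2.mono_set (by
        rw [uIcc_of_le hxR.le, uIcc_of_le (hyx.le.trans hxR.le)]
        exact Icc_subset_Icc_left hyx.le)
    rw [e1]
    calc ∫ t in x..R, g (n + 1) t * ((t - x) ^ n / n.factorial)
        ≤ ∫ t in x..R, q ^ n * (g (n + 1) t * ((t - y) ^ n / n.factorial)) := by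
          refine intervalIntegral.integral_mono_on hxR.le i1 (i3.const_mul _) fun t ht => ?_
          have h1 : t - x ≤ q * (t - y) := by
            rw [hq, div_mul_eq_mul_div, le_div_iff₀ (by linarith)]
            nlinarith [mul_nonneg (sub_nonneg.2 hyx.le) (sub_nonneg.2 ht.2)]
          have h2 : (t - x) ^ n ≤ q ^ n * (t - y) ^ n := by
            rw [← mul_pow]
            exact pow_le_pow_left₀ (by linarith [ht.1]) h1 n
          have h3 := hg.nonneg (n + 1) (hx.trans_le ht.1)
          calc g (n + 1) t * ((t - x) ^ n / n.factorial)
              ≤ g (n + 1) t * ((q ^ n * (t - y) ^ n) / n.factorial) := by gcongr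
            _ = _ := by ring
      _ = q ^ n * ∫ t in x..R, g (n + 1) t * ((t - y) ^ n / n.factorial) := by
          rw [intervalIntegral.integral_const_mul]
      _ ≤ q ^ n * ∫ t in y..R, g (n + 1) t * ((t - y) ^ n / n.factorial) := by
          refine mul_le_mul_of_nonneg_left ?_ (pow_nonneg hq0 n)
          refine intervalIntegral.integral_mono_interval hyx.le hxR.le le_rfl ?_ i2
          refine (ae_restrict_iff' measurableSet_Ioc).2 (Eventually.of_forall fun t ht => ?_)
          have h3 := hg.nonneg (n + 1) (hy0.trans ht.1)
          have : 0 ≤ t - y := by linarith [ht.1]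
          simp only [Pi.zero_apply]
          positivity
      _ ≤ q ^ n * g 0 y := by
          refine mul_le_mul_of_nonneg_left ?_ (pow_nonneg hq0 n)
          rw [← e2, sub_le_self_iff]
          refine Finset.sum_nonneg fun k _ => mul_nonneg (hg.nonneg k hR) ?_
          have : 0 ≤ R - y := by linarith
          positivity
  have key0 : ∀ n : ℕ,
      0 ≤ g 0 x - ∑ k ∈ Finset.range (n + 1), g k R * ((R - x) ^ k / k.factorial) := by
    intro n
    obtain ⟨i1, e1⟩ := hg.taylor_remainder hx hxR.le n
    rw [e1]
    refine intervalIntegral.integral_nonneg hxR.le fun t ht => ?_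
    have h3 := hg.nonneg (n + 1) (hx.trans_le ht.1)
    have : 0 ≤ t - x := by linarith [ht.1]
    positivity
  have hlim : Tendsto (fun n : ℕ => q ^ n * g 0 y) atTop (𝓝 0) := by
    simpa using (tendsto_pow_atTop_nhds_zero_of_lt_one hq0 hq1).mul_const (g 0 y)
  have := squeeze_zero key0 key hlim
  simpa using this.const_sub (g 0 x)

end IsCMSequence

/-! ### A representing measure on the unit interval, by weak compactness. -/

namespace IsCMSequence

variable {g : ℕ → ℝ → ℝ}

/-- The point `e^{-s}` of the unit interval, for `s ≥ 0`. -/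
def expNeg (s : ℝ) (hs : 0 ≤ s) : unitInterval :=
  ⟨Real.exp (-s), (Real.exp_pos _).le, Real.exp_le_one_iff.2 (by linarith)⟩

/-- The discrete measures approximating the representing measure of `x ↦ g 0 (1 + x)`. -/
def approxMeasure (g : ℕ → ℝ → ℝ) (n : ℕ) : Measure unitInterval :=
  Measure.sum fun k : ℕ =>
    ENNReal.ofReal (g k (n + 2) * ((n + 1 : ℝ) ^ k / k.factorial)) •
      Measure.dirac (expNeg (k / (n + 1 : ℝ)) (by positivity))

theorem approxMeasure_univ (hg : IsCMSequence g) (n : ℕ) :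
    approxMeasure g n univ = ENNReal.ofReal (g 0 1) := by
  have h := hg.hasSum_taylor (x := 1) (R := n + 2) one_pos (by linarith [n.cast_nonneg (α := ℝ)])
  have e : ∀ k : ℕ, g k (n + 2) * (((n : ℝ) + 2 - 1) ^ k / k.factorial) =
      g k (n + 2) * ((n + 1 : ℝ) ^ k / k.factorial) := fun k => by
    congr 3; ring
  simp_rw [e] at h
  have h0 : ∀ k : ℕ, 0 ≤ g k (n + 2) * ((n + 1 : ℝ) ^ k / k.factorial) := fun k =>
    mul_nonneg (hg.nonneg k (by positivity)) (by positivity)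
  rw [approxMeasure, Measure.sum_apply _ MeasurableSet.univ, ← h.tsum_eq,
    ENNReal.ofReal_tsum_of_nonneg h0 h.summable]
  simp

/-- With `e = exp(-x/(n+1))`, the atom at `exp(-k/(n+1))` contributes `e^k`, and the sum is the
Taylor series about `n+2` at the point whose distance from `n+2` is `(n+1)e`. That point tends to `1
+ x`. -/
theorem integral_approxMeasure (hg : IsCMSequence g) (n : ℕ) {x : ℝ} (hx : 0 < x) :
    ∫ t, (t : ℝ) ^ x ∂approxMeasure g n =
      g 0 (1 + (n + 1) * (1 - Real.exp (-(x / (n + 1))))) := by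
  have hfin : IsFiniteMeasure (approxMeasure g n) := ⟨by
    rw [hg.approxMeasure_univ]; exact ENNReal.ofReal_lt_top⟩
  have hn : (0 : ℝ) < n + 1 := by positivity
  have hint : Integrable (fun t : unitInterval => (t : ℝ) ^ x) (approxMeasure g n) := by
    refine Integrable.of_bound (C := 1)
      (Continuous.aestronglyMeasurable ?_) (Eventually.of_forall fun t => ?_)
    · exact continuous_subtype_val.rpow_const fun _ => Or.inr hx.le
    · rw [Real.norm_of_nonneg (Real.rpow_nonneg t.2.1 _)]
      exact Real.rpow_le_one t.2.1 t.2.2 hx.le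
  have hs := hasSum_integral_measure hint
  set e := Real.exp (-(x / (n + 1))) with he
  have he0 : 0 < e := Real.exp_pos _
  have he1 : e < 1 := Real.exp_lt_one_iff.2 (neg_neg_of_pos (by positivity))
  have h := hg.hasSum_taylor (x := 1 + (n + 1) * (1 - e)) (R := n + 2)
    (by nlinarith [mul_pos hn (sub_pos.2 he1)]) (by nlinarith [mul_pos hn he0])
  refine hs.unique (h.congr_fun fun k => ?_)
  rw [integral_smul_measure, integral_dirac,
    ENNReal.toReal_ofReal (mul_nonneg (hg.nonneg k (by positivity)) (by positivity))]
  have : ((expNeg (k / (n + 1 : ℝ)) (by positivity) : unitInterval) : ℝ) ^ x = e ^ k := by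
    simp only [expNeg, he]
    rw [← Real.exp_mul, ← Real.exp_nat_mul]
    congr 1
    ring
  rw [this, smul_eq_mul, show (n : ℝ) + 2 - (1 + (n + 1) * (1 - e)) = (n + 1) * e by ring, mul_pow]
  ring

theorem exists_measure_unitInterval (hg : IsCMSequence g) :
    ∃ μ : FiniteMeasure unitInterval, ∀ x : ℝ, 0 < x →
      ∫ t, (t : ℝ) ^ x ∂(μ : Measure unitInterval) = g 0 (1 + x) := by
  have hfin : ∀ n, IsFiniteMeasure (approxMeasure g n) := fun n => ⟨by
    rw [hg.approxMeasure_univ]; exact ENNReal.ofReal_lt_top⟩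
  let m : ℕ → FiniteMeasure unitInterval := fun n => ⟨approxMeasure g n, hfin n⟩
  have hK := isCompact_setOfPred_finiteMeasure_le_of_compactSpace unitInterval (g 0 1).toNNReal
  have hm : ∀ n, m n ∈ {μ : FiniteMeasure unitInterval | μ.mass ≤ (g 0 1).toNNReal} := fun n => by
    have : (m n).mass = (g 0 1).toNNReal := by
      rw [← ENNReal.coe_inj, FiniteMeasure.ennreal_mass]
      exact hg.approxMeasure_univ n
    exact this.le
  -- A limit along a free ultrafilter replaces the extraction of a weakly convergent subsequence.
  let U : Ultrafilter ℕ := hyperfilter ℕ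
  obtain ⟨μ, -, hμ⟩ := hK.ultrafilter_le_nhds (U.map m)
    (le_principal_iff.2 (Filter.mem_map.2 (Filter.univ_mem' hm)))
  have hμ' : Tendsto m U (𝓝 μ) := hμ
  refine ⟨μ, fun x hx => ?_⟩
  let F : BoundedContinuousFunction unitInterval ℝ :=
    BoundedContinuousFunction.mkOfCompact
      ⟨fun t => (t : ℝ) ^ x, continuous_subtype_val.rpow_const fun _ => Or.inr hx.le⟩
  have h1 := (FiniteMeasure.tendsto_iff_forall_integral_tendsto.1 hμ') F
  have h2 : ∀ n, ∫ t, F t ∂(m n : Measure unitInterval) =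
      g 0 (1 + (n + 1) * (1 - Real.exp (-(x / (n + 1))))) := fun n =>
    hg.integral_approxMeasure n hx
  simp_rw [h2] at h1
  refine tendsto_nhds_unique h1 (Tendsto.mono_left ?_ (Nat.hyperfilter_le_atTop))
  have h3 : Tendsto (fun n : ℕ => ((n : ℝ) + 1) * (1 - Real.exp (-(x / (n + 1))))) atTop
      (𝓝 x) := by
    -- The limit is the derivative of `1 - exp(-xs)` at `s = 0`, sampled at `s = 1/(n+1)`.
    have hd : HasDerivAt (fun s => 1 - Real.exp (-(x * s))) x 0 := by
      have := ((((hasDerivAt_id (0 : ℝ)).const_mul x).neg).exp).const_sub 1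
      refine this.congr_deriv ?_
      simp
    have h4 : Tendsto (fun n : ℕ => 1 / ((n : ℝ) + 1)) atTop (𝓝[≠] 0) :=
      tendsto_nhdsWithin_iff.2 ⟨tendsto_one_div_add_atTop_nhds_zero_nat,
        Eventually.of_forall fun n => by
          have : (0 : ℝ) < 1 / (n + 1) := by positivity
          exact this.ne'⟩
    refine (hd.tendsto_slope_zero.comp h4).congr fun n => ?_
    simp [div_eq_mul_inv]
  exact ((hg.hasDerivAt 0 (by linarith : 0 < 1 + x)).continuousAt.tendsto).comp (h3.const_add 1)

end IsCMSequence

/-! ### Bernstein's theorem. -/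

namespace IsCMSequence

variable {g : ℕ → ℝ → ℝ}

theorem exists_finite_measure_laplace (hg : IsCMSequence g) :
    ∃ σ : Measure ℝ, IsFiniteMeasure σ ∧ (∀ᵐ s ∂σ, 0 ≤ s) ∧ ∀ x : ℝ, 0 < x →
      ∫⁻ s, ENNReal.ofReal (Real.exp (-(x * s))) ∂σ = ENNReal.ofReal (g 0 (1 + x)) := by
  obtain ⟨μ, hμ⟩ := hg.exists_measure_unitInterval
  have hS : MeasurableSet {t : unitInterval | 0 < (t : ℝ)} :=
    measurableSet_lt measurable_const measurable_subtype_coe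
  have hL : Measurable (fun t : unitInterval => -Real.log t) := by fun_prop
  -- The substitution is `s = -log t`. A possible atom at `t = 0` must be discarded: it contributes
  -- `0^x = 0`, but the convention `log 0 = 0` would move it to `s = 0`.
  refine ⟨((μ : Measure unitInterval).restrict {t | 0 < (t : ℝ)}).map
    (fun t : unitInterval => -Real.log t),
    inferInstance, ?_, fun x hx => ?_⟩
  · rw [ae_map_iff hL.aemeasurable measurableSet_Ici]
    exact Eventually.of_forall fun t => neg_nonneg.2 (Real.log_nonpos t.2.1 t.2.2)
  · rw [lintegral_map (f := fun s => ENNReal.ofReal (Real.exp (-(x * s)))) (by fun_prop) hL,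
      ← hμ x hx]
    have h1 : ∫⁻ t in {t : unitInterval | 0 < (t : ℝ)},
        ENNReal.ofReal (Real.exp (-(x * -Real.log t))) ∂(μ : Measure unitInterval) =
        ∫⁻ t in {t : unitInterval | 0 < (t : ℝ)},
          ENNReal.ofReal ((t : ℝ) ^ x) ∂(μ : Measure unitInterval) := by
      refine setLIntegral_congr_fun hS fun t ht => ?_
      have ht' : 0 < (t : ℝ) := ht
      simp only [Real.rpow_def_of_pos ht']
      congr 2; ring
    rw [h1, setLIntegral_eq_of_support_subset, ofReal_integral_eq_lintegral_ofReal]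
    · refine Integrable.of_bound (C := 1)
        (Continuous.aestronglyMeasurable ?_) (Eventually.of_forall fun t => ?_)
      · exact continuous_subtype_val.rpow_const fun _ => Or.inr hx.le
      · rw [Real.norm_of_nonneg (Real.rpow_nonneg t.2.1 _)]
        exact Real.rpow_le_one t.2.1 t.2.2 hx.le
    · exact Eventually.of_forall fun t => Real.rpow_nonneg t.2.1 _
    · intro t ht
      by_contra h
      have h0 : (t : ℝ) = 0 := le_antisymm (not_lt.1 h) t.2.1
      simp [h0, Real.zero_rpow hx.ne'] at ht

/-- Differentiate the moment generating function of `-s` under the integral, once per induction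
step. -/
theorem moment_eq (hg : IsCMSequence g) {σ : Measure ℝ}
    (hσ : ∀ x : ℝ, 0 < x →
      ∫⁻ s, ENNReal.ofReal (Real.exp (-(x * s))) ∂σ = ENNReal.ofReal (g 0 (1 + x)))
    (k : ℕ) {x : ℝ} (hx : 0 < x) :
    Integrable (fun s => (-s) ^ k * Real.exp (x * -s)) σ ∧
      ∫ s, (-s) ^ k * Real.exp (x * -s) ∂σ = (-1) ^ k * g k (1 + x) := by
  have hexp : ∀ x : ℝ, 0 < x → Integrable (fun s => Real.exp (x * -s)) σ := fun x hx => by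
    refine (lintegral_ofReal_ne_top_iff_integrable (by fun_prop)
      (Eventually.of_forall fun s => (Real.exp_pos _).le)).1 ?_
    simp_rw [mul_neg]
    rw [hσ x hx]
    exact ENNReal.ofReal_ne_top
  have hsub : ∀ x : ℝ, 0 < x →
      x ∈ interior (ProbabilityTheory.integrableExpSet (fun s : ℝ => -s) σ) := fun x hx =>
    interior_maximal (fun y hy => hexp y hy) isOpen_Ioi hx
  refine ⟨ProbabilityTheory.integrable_pow_mul_exp_of_mem_interior_integrableExpSet
    (hsub x hx) k, ?_⟩
  induction k generalizing x with
  | zero =>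
    simp only [pow_zero, one_mul]
    rw [integral_eq_lintegral_of_nonneg_ae (Eventually.of_forall fun s => (Real.exp_pos _).le)
      (by fun_prop)]
    simp_rw [mul_neg]
    rw [hσ x hx, ENNReal.toReal_ofReal (hg.nonneg 0 (by linarith))]
  | succ k ih =>
    have h1 := ProbabilityTheory.hasDerivAt_integral_pow_mul_exp_real (hsub x hx) k
    have h2 : HasDerivAt (fun t => (-1) ^ k * g k (1 + t)) ((-1) ^ k * -(g (k + 1) (1 + x))) x :=
      ((hg.hasDerivAt k (by linarith : 0 < 1 + x)).comp_const_add 1 x).const_mul _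
    have h3 := h1.congr_of_eventuallyEq (f₁ := fun t => (-1) ^ k * g k (1 + t)) (by
      filter_upwards [Ioi_mem_nhds hx] with t ht using (ih ht).symm)
    rw [h3.unique h2]
    ring

theorem exists_measure_laplace (hg : IsCMSequence g) :
    ∃ ν : Measure ℝ, SFinite ν ∧ (∀ᵐ s ∂ν, 0 ≤ s) ∧ ∀ x : ℝ, 0 < x →
      ∫⁻ s, ENNReal.ofReal (Real.exp (-(x * s))) ∂ν = ENNReal.ofReal (g 0 x) := by
  obtain ⟨σ, hfin, h0, hσ⟩ := hg.exists_finite_measure_laplace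
  -- The density `e^s` undoes the shift of the argument by `1`.
  refine ⟨σ.withDensity fun s => ENNReal.ofReal (Real.exp s), inferInstance,
    (withDensity_absolutelyContinuous _ _).ae_le h0, fun y hy => ?_⟩
  rw [lintegral_withDensity_eq_lintegral_mul _ (by fun_prop) (by fun_prop)]
  have e1 : ∀ s : ℝ, ((fun s => ENNReal.ofReal (Real.exp s)) *
      fun s => ENNReal.ofReal (Real.exp (-(y * s)))) s = ENNReal.ofReal (Real.exp ((1 - y) * s)) :=
    fun s => by
      simp only [Pi.mul_apply]
      rw [← ENNReal.ofReal_mul (Real.exp_pos _).le, ← Real.exp_add]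
      congr 2; ring
  simp_rw [e1]
  rcases lt_or_ge 1 y with h | h
  · have := hσ (y - 1) (by linarith)
    rw [show 1 + (y - 1) = y by ring] at this
    rw [← this]
    congr 1; ext s; congr 2; ring
  -- For `y ≤ 1` the formula for `σ` no longer applies. Expand about `2` instead: the coefficients
  -- are moments of `e^(-s) dσ`, all terms are nonnegative, and summing inside the integral gives
  -- `e^(-s) e^((2-y)s)`.
  have hs := hg.hasSum_taylor hy (by linarith : y < 2)
  have hnn : ∀ k : ℕ, 0 ≤ g k 2 * ((2 - y) ^ k / k.factorial) := fun k =>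
    mul_nonneg (hg.nonneg k two_pos) (by have : 0 ≤ 2 - y := by linarith
                                         positivity)
  rw [← hs.tsum_eq, ENNReal.ofReal_tsum_of_nonneg hnn hs.summable]
  have e2 : ∀ k : ℕ, ENNReal.ofReal (g k 2 * ((2 - y) ^ k / k.factorial)) =
      ∫⁻ s, ENNReal.ofReal (Real.exp (-s) * (((2 - y) * s) ^ k / k.factorial)) ∂σ := fun k => by
    obtain ⟨i, e⟩ := hg.moment_eq hσ k one_pos
    have e3 : ∀ s : ℝ, Real.exp (-s) * (((2 - y) * s) ^ k / k.factorial) =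
        ((-1) ^ k * ((2 - y) ^ k / k.factorial)) * ((-s) ^ k * Real.exp (1 * -s)) := fun s => by
      rw [neg_pow s k, one_mul, mul_pow]
      have : ((-1 : ℝ) ^ k) * (-1) ^ k = 1 := by rw [← mul_pow]; norm_num
      linear_combination (-(2 - y) ^ k / k.factorial * s ^ k * Real.exp (-s)) * this
    simp_rw [e3]
    rw [← ofReal_integral_eq_lintegral_ofReal (i.const_mul _), integral_const_mul, e]
    · congr 1
      have : ((-1 : ℝ) ^ k) * (-1) ^ k = 1 := by rw [← mul_pow]; norm_num
      rw [show (1 : ℝ) + 1 = 2 by norm_num]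
      linear_combination (-(2 - y) ^ k / k.factorial * g k 2) * this
    · filter_upwards [h0] with s hs
      simp only [Pi.zero_apply]
      rw [← e3]
      have : 0 ≤ (2 - y) * s := mul_nonneg (by linarith) hs
      positivity
  simp_rw [e2]
  rw [← lintegral_tsum (fun k => by fun_prop)]
  refine lintegral_congr_ae ?_
  filter_upwards [h0] with s hs
  have hp : 0 ≤ (2 - y) * s := mul_nonneg (by linarith) hs
  have h5 := (NormedSpace.expSeries_div_hasSum_exp ((2 - y) * s)).mul_left (Real.exp (-s))
  rw [← Real.exp_eq_exp_ℝ] at h5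
  rw [← ENNReal.ofReal_tsum_of_nonneg (fun k => by positivity) h5.summable, h5.tsum_eq,
    ← Real.exp_add]
  congr 2; ring

end IsCMSequence

/-- **Bernstein's theorem**: completely monotonic functions are Laplace transforms. -/
theorem CompletelyMonotonic.exists_measure_laplace {f : ℝ → ℝ} (hf : CompletelyMonotonic f) :
    ∃ ν : Measure ℝ, SFinite ν ∧ (∀ᵐ s ∂ν, 0 ≤ s) ∧ ∀ x : ℝ, 0 < x →
      ∫⁻ s, ENNReal.ofReal (Real.exp (-(x * s))) ∂ν = ENNReal.ofReal (f x) := by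
  simpa using hf.isCMSequence.exists_measure_laplace

/-! ### Weighted primitives of decreasing kernels. -/

/-- Admissible kernels: measurable functions which on `[0,∞)` are nonnegative, continuous and
nonincreasing. -/
structure IsDecayKernel (k : ℝ → ℝ) : Prop where
  measurable : Measurable k
  continuousOn : ContinuousOn k (Ici 0)
  antitoneOn : AntitoneOn k (Ici 0)
  nonneg : ∀ u, 0 ≤ u → 0 ≤ k u

/-- The weighted primitive `∫_0^y u^{lam-1} k(u) du`. -/
def weightedPrimitive (lam : ℝ) (k : ℝ → ℝ) (y : ℝ) : ℝ :=
  ∫ u in (0 : ℝ)..y, u ^ (lam - 1) * k u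

theorem weightedPrimitive_div_eq {k : ℝ → ℝ} {lam x t : ℝ} (hx : 0 < x) (ht : 0 < t) :
    weightedPrimitive lam k (x * t) / t ^ lam = ∫ y in (0 : ℝ)..x, y ^ (lam - 1) * k (y * t) := by
  have h := intervalIntegral.integral_comp_mul_right (a := 0) (b := x)
    (fun u => u ^ (lam - 1) * k u) ht.ne'
  rw [zero_mul] at h
  have h2 : ∫ y in (0 : ℝ)..x, (y * t) ^ (lam - 1) * k (y * t) =
      t ^ (lam - 1) * ∫ y in (0 : ℝ)..x, y ^ (lam - 1) * k (y * t) := by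
    rw [← intervalIntegral.integral_const_mul]
    refine intervalIntegral.integral_congr fun y hy => ?_
    rw [uIcc_of_le hx.le] at hy
    rw [Real.mul_rpow hy.1 ht.le]
    ring
  rw [h2, smul_eq_mul, eq_inv_mul_iff_mul_eq₀ ht.ne'] at h
  have h3 : t ^ lam = t ^ (lam - 1) * t := by
    rw [← Real.rpow_add_one ht.ne']; congr 1; ring
  have h4 : 0 < t ^ (lam - 1) := Real.rpow_pos_of_pos ht _
  rw [weightedPrimitive, h3, div_eq_iff (by positivity), ← h]
  ring

namespace IsDecayKernel

variable {k : ℝ → ℝ} {lam : ℝ}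

theorem intervalIntegrable (hk : IsDecayKernel k) (hlam : 0 < lam) {y : ℝ} (hy : 0 ≤ y) (t : ℝ)
    (ht : 0 ≤ t) :
    IntervalIntegrable (fun u => u ^ (lam - 1) * k (u * t)) volume 0 y := by
  refine (intervalIntegral.intervalIntegrable_rpow' (by linarith)).mul_continuousOn ?_
  rw [uIcc_of_le hy]
  exact hk.continuousOn.comp (by fun_prop) fun u hu => mul_nonneg hu.1 ht

theorem ofReal_weightedPrimitive (hk : IsDecayKernel k) (hlam : 0 < lam) {x t : ℝ} (hx : 0 < x)
    (ht : 0 < t) :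
    ENNReal.ofReal (weightedPrimitive lam k (x * t) / t ^ lam) =
      ∫⁻ y in Ioc 0 x, ENNReal.ofReal (y ^ (lam - 1)) * ENNReal.ofReal (k (y * t)) := by
  rw [weightedPrimitive_div_eq hx ht, intervalIntegral.integral_of_le hx.le,
    ofReal_integral_eq_lintegral_ofReal]
  · refine setLIntegral_congr_fun measurableSet_Ioc fun y hy => ?_
    exact ENNReal.ofReal_mul (Real.rpow_nonneg hy.1.le _)
  · exact (intervalIntegrable_iff_integrableOn_Ioc_of_le hx.le).1
      (hk.intervalIntegrable hlam hx.le t ht.le)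
  · refine (ae_restrict_iff' measurableSet_Ioc).2 (Eventually.of_forall fun y hy => ?_)
    exact mul_nonneg (Real.rpow_nonneg hy.1.le _) (hk.nonneg _ (mul_nonneg hy.1.le ht.le))

theorem weightedPrimitive_div_nonneg (hk : IsDecayKernel k) {x t : ℝ}
    (hx : 0 < x) (ht : 0 < t) : 0 ≤ weightedPrimitive lam k (x * t) / t ^ lam := by
  refine div_nonneg (intervalIntegral.integral_nonneg (mul_pos hx ht).le fun u hu => ?_)
    (Real.rpow_nonneg ht.le _)
  exact mul_nonneg (Real.rpow_nonneg hu.1 _) (hk.nonneg _ hu.1)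

theorem continuousOn_weightedPrimitive (hk : IsDecayKernel k) (hlam : 0 < lam) :
    ContinuousOn (weightedPrimitive lam k) (Ici 0) := by
  intro y hy
  have hi : IntegrableOn (fun u => u ^ (lam - 1) * k u) (uIcc 0 (y + 1)) := by
    have := hk.intervalIntegrable hlam (y := y + 1) (by linarith [mem_Ici.1 hy]) 1 zero_le_one
    simp only [mul_one] at this
    rw [uIcc_of_le (by linarith [mem_Ici.1 hy])]
    exact (intervalIntegrable_iff_integrableOn_Icc_of_le (by linarith [mem_Ici.1 hy])).1 this
  have h := intervalIntegral.continuousOn_primitive_interval hi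
  rw [uIcc_of_le (by linarith [mem_Ici.1 hy])] at h
  have h2 := h y ⟨hy, by linarith⟩
  refine h2.mono_of_mem_nhdsWithin ?_
  rw [← Ici_inter_Iic]
  exact inter_mem self_mem_nhdsWithin (mem_nhdsWithin_of_mem_nhds (Iic_mem_nhds (by linarith)))

theorem aestronglyMeasurable_weightedPrimitive (hk : IsDecayKernel k) (hlam : 0 < lam)
    (κ : Measure ℝ) {x : ℝ} (hx : 0 < x) :
    AEStronglyMeasurable (fun t => weightedPrimitive lam k (x * t) / t ^ lam)
      (κ.restrict (Ioi 0)) := by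
  refine ContinuousOn.aestronglyMeasurable (ContinuousOn.div ?_ ?_ ?_) measurableSet_Ioi
  · exact (hk.continuousOn_weightedPrimitive hlam).comp (by fun_prop)
      fun t ht => (mul_pos hx ht).le
  · exact ContinuousOn.rpow_const (by fun_prop) fun t ht => Or.inl (ne_of_gt ht)
  · exact fun t ht => (Real.rpow_pos_of_pos ht _).ne'

variable {κ : Measure ℝ}

theorem lintegral_weightedPrimitive [SFinite κ] (hk : IsDecayKernel k) (hlam : 0 < lam) {x : ℝ} (hx : 0 < x) :
    ∫⁻ t in Ioi 0, ENNReal.ofReal (weightedPrimitive lam k (x * t) / t ^ lam) ∂κ =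
      ∫⁻ y in Ioc 0 x, ENNReal.ofReal (y ^ (lam - 1)) *
        ∫⁻ t in Ioi 0, ENNReal.ofReal (k (y * t)) ∂κ := by
  have hm := hk.measurable
  rw [setLIntegral_congr_fun measurableSet_Ioi
    (fun t ht => hk.ofReal_weightedPrimitive hlam hx ht)]
  rw [lintegral_lintegral_swap (by fun_prop)]
  refine lintegral_congr fun y => ?_
  rw [lintegral_const_mul _ (by fun_prop)]

theorem continuousOn_integral (hk : IsDecayKernel k)
    (hint : ∀ x, 0 < x → IntegrableOn (fun t => k (x * t)) (Ioi 0) κ) :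
    ContinuousOn (fun x => ∫ t in Ioi 0, k (x * t) ∂κ) (Ioi 0) := by
  intro x hx
  have hx : 0 < x := hx
  refine ContinuousAt.continuousWithinAt ?_
  refine continuousAt_of_dominated (bound := fun t => k (x / 2 * t)) ?_ ?_ (hint _ (by linarith)) ?_
  · have hm := hk.measurable
    exact Eventually.of_forall fun y => (by fun_prop : Measurable fun t => k (y * t)).aestronglyMeasurable
  · filter_upwards [Ioi_mem_nhds (half_lt_self hx)] with y hy
    refine (ae_restrict_iff' measurableSet_Ioi).2 (Eventually.of_forall fun t ht => ?_)
    have ht : 0 < t := ht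
    have hy : x / 2 < y := hy
    have hy0 : 0 < y := by linarith
    rw [Real.norm_of_nonneg (hk.nonneg _ (by positivity))]
    exact hk.antitoneOn (mem_Ici.2 (by positivity)) (mem_Ici.2 (by positivity)) (by gcongr)
  · refine (ae_restrict_iff' measurableSet_Ioi).2 (Eventually.of_forall fun t ht => ?_)
    have ht : 0 < t := ht
    have h : ContinuousAt k (x * t) :=
      hk.continuousOn.continuousAt (Ici_mem_nhds (by positivity))
    exact ContinuousAt.comp (f := fun y => y * t) h (by fun_prop)

theorem integral_nonneg (hk : IsDecayKernel k) {x : ℝ} (hx : 0 < x) :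
    0 ≤ ∫ t in Ioi 0, k (x * t) ∂κ :=
  setIntegral_nonneg measurableSet_Ioi fun _ ht => hk.nonneg _ (mul_pos hx ht).le

theorem ofReal_integral (hk : IsDecayKernel k) {x : ℝ} (hx : 0 < x)
    (hint : IntegrableOn (fun t => k (x * t)) (Ioi 0) κ) :
    ENNReal.ofReal (∫ t in Ioi 0, k (x * t) ∂κ) = ∫⁻ t in Ioi 0, ENNReal.ofReal (k (x * t)) ∂κ :=
  ofReal_integral_eq_lintegral_ofReal hint <| (ae_restrict_iff' measurableSet_Ioi).2
    (Eventually.of_forall fun _ ht => hk.nonneg _ (mul_pos hx ht).le)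

theorem lintegral_weightedPrimitive' [SFinite κ] (hk : IsDecayKernel k) (hlam : 0 < lam)
    (hint : ∀ x, 0 < x → IntegrableOn (fun t => k (x * t)) (Ioi 0) κ) {x : ℝ} (hx : 0 < x) :
    ∫⁻ t in Ioi 0, ENNReal.ofReal (weightedPrimitive lam k (x * t) / t ^ lam) ∂κ =
      ∫⁻ y in Ioc 0 x, ENNReal.ofReal (y ^ (lam - 1) * ∫ t in Ioi 0, k (y * t) ∂κ) := by
  rw [hk.lintegral_weightedPrimitive hlam hx]
  refine setLIntegral_congr_fun measurableSet_Ioc fun y hy => ?_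
  rw [ENNReal.ofReal_mul (Real.rpow_nonneg hy.1.le _), hk.ofReal_integral hy.1 (hint y hy.1)]

theorem aestronglyMeasurable_integral (hk : IsDecayKernel k)
    (hint : ∀ x, 0 < x → IntegrableOn (fun t => k (x * t)) (Ioi 0) κ) (x : ℝ) :
    AEStronglyMeasurable (fun y => y ^ (lam - 1) * ∫ t in Ioi 0, k (y * t) ∂κ)
      (volume.restrict (Ioc 0 x)) := by
  refine ContinuousOn.aestronglyMeasurable (ContinuousOn.mul ?_ ?_) measurableSet_Ioc
  · exact ContinuousOn.rpow_const (by fun_prop) fun t ht => Or.inl (ne_of_gt ht.1)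
  · exact (hk.continuousOn_integral hint).mono fun t ht => ht.1

theorem integrableOn_weightedPrimitive_iff [SFinite κ] (hk : IsDecayKernel k) (hlam : 0 < lam)
    (hint : ∀ x, 0 < x → IntegrableOn (fun t => k (x * t)) (Ioi 0) κ) {x : ℝ} (hx : 0 < x) :
    IntegrableOn (fun t => weightedPrimitive lam k (x * t) / t ^ lam) (Ioi 0) κ ↔
      IntegrableOn (fun y => y ^ (lam - 1) * ∫ t in Ioi 0, k (y * t) ∂κ) (Ioc 0 x) := by
  rw [IntegrableOn, IntegrableOn,
    ← lintegral_ofReal_ne_top_iff_integrable (hk.aestronglyMeasurable_weightedPrimitive hlam κ hx),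
    ← lintegral_ofReal_ne_top_iff_integrable (hk.aestronglyMeasurable_integral hint x),
    hk.lintegral_weightedPrimitive' hlam hint hx]
  · exact (ae_restrict_iff' measurableSet_Ioc).2 (Eventually.of_forall fun y hy =>
      mul_nonneg (Real.rpow_nonneg hy.1.le _) (hk.integral_nonneg hy.1))
  · exact (ae_restrict_iff' measurableSet_Ioi).2 (Eventually.of_forall fun t ht =>
      hk.weightedPrimitive_div_nonneg hx ht)

theorem integral_weightedPrimitive [SFinite κ] (hk : IsDecayKernel k) (hlam : 0 < lam)
    (hint : ∀ x, 0 < x → IntegrableOn (fun t => k (x * t)) (Ioi 0) κ) {x : ℝ} (hx : 0 < x) :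
    ∫ t in Ioi 0, weightedPrimitive lam k (x * t) / t ^ lam ∂κ =
      ∫ y in (0 : ℝ)..x, y ^ (lam - 1) * ∫ t in Ioi 0, k (y * t) ∂κ := by
  rw [intervalIntegral.integral_of_le hx.le, integral_eq_lintegral_of_nonneg_ae _
    (hk.aestronglyMeasurable_weightedPrimitive hlam κ hx), integral_eq_lintegral_of_nonneg_ae _
    (hk.aestronglyMeasurable_integral hint x), hk.lintegral_weightedPrimitive' hlam hint hx]
  · exact (ae_restrict_iff' measurableSet_Ioc).2 (Eventually.of_forall fun y hy =>
      mul_nonneg (Real.rpow_nonneg hy.1.le _) (hk.integral_nonneg hy.1))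
  · exact (ae_restrict_iff' measurableSet_Ioi).2 (Eventually.of_forall fun t ht =>
      hk.weightedPrimitive_div_nonneg hx ht)

/-- As `k` decreases, replacing `k(yt)` by `k(xt)` for `y ≤ x` bounds the weighted primitive below
by `(x^lam / lam) k(xt)`. -/
theorem integrableOn_of_weightedPrimitive (hk : IsDecayKernel k) (hlam : 0 < lam) {x : ℝ}
    (hx : 0 < x)
    (h : IntegrableOn (fun t => weightedPrimitive lam k (x * t) / t ^ lam) (Ioi 0) κ) :
    IntegrableOn (fun t => k (x * t)) (Ioi 0) κ := by
  have hm := hk.measurable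
  have hc : 0 < x ^ lam / lam := by positivity
  have hle : ∀ t ∈ Ioi (0 : ℝ), x ^ lam / lam * k (x * t) ≤
      weightedPrimitive lam k (x * t) / t ^ lam := fun t ht => by
    have ht : 0 < t := ht
    rw [weightedPrimitive_div_eq hx ht]
    have e : x ^ lam / lam * k (x * t) = ∫ y in (0 : ℝ)..x, y ^ (lam - 1) * k (x * t) := by
      rw [intervalIntegral.integral_mul_const, integral_rpow (Or.inl (by linarith))]
      simp [Real.zero_rpow hlam.ne']
    rw [e]
    refine intervalIntegral.integral_mono_on hx.le
      ((intervalIntegral.intervalIntegrable_rpow' (by linarith)).mul_const _)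
      (hk.intervalIntegrable hlam hx.le t ht.le) fun y hy => ?_
    refine mul_le_mul_of_nonneg_left ?_ (Real.rpow_nonneg hy.1 _)
    exact hk.antitoneOn (mem_Ici.2 (mul_nonneg hy.1 ht.le)) (mem_Ici.2 (by positivity))
      (mul_le_mul_of_nonneg_right hy.2 ht.le)
  refine (Integrable.mono' (h.const_mul (x ^ lam / lam)⁻¹)
    (by fun_prop : Measurable fun t => k (x * t)).aestronglyMeasurable ?_)
  refine (ae_restrict_iff' measurableSet_Ioi).2 (Eventually.of_forall fun t ht => ?_)
  rw [Real.norm_of_nonneg (hk.nonneg _ (mul_pos hx ht).le)]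
  have := hle t ht
  rw [← div_eq_inv_mul, le_div_iff₀ hc]
  linarith

theorem hasDerivAt_integral_weightedPrimitive [SFinite κ] (hk : IsDecayKernel k) (hlam : 0 < lam)
    (h : ∀ x, 0 < x →
      IntegrableOn (fun t => weightedPrimitive lam k (x * t) / t ^ lam) (Ioi 0) κ)
    {x : ℝ} (hx : 0 < x) :
    HasDerivAt (fun x => ∫ t in Ioi 0, weightedPrimitive lam k (x * t) / t ^ lam ∂κ)
      (x ^ (lam - 1) * ∫ t in Ioi 0, k (x * t) ∂κ) x := by
  have hint : ∀ x, 0 < x → IntegrableOn (fun t => k (x * t)) (Ioi 0) κ := fun x hx =>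
    hk.integrableOn_of_weightedPrimitive hlam hx (h x hx)
  have hcont : ContinuousOn (fun y => y ^ (lam - 1) * ∫ t in Ioi 0, k (y * t) ∂κ) (Ioi 0) :=
    ContinuousOn.mul (ContinuousOn.rpow_const (by fun_prop) fun t ht => Or.inl (ne_of_gt ht))
      (hk.continuousOn_integral hint)
  have hii : IntervalIntegrable (fun y => y ^ (lam - 1) * ∫ t in Ioi 0, k (y * t) ∂κ) volume 0 x :=
    (intervalIntegrable_iff_integrableOn_Ioc_of_le hx.le).2
      ((hk.integrableOn_weightedPrimitive_iff hlam hint hx).1 (h x hx))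
  have hd := intervalIntegral.integral_hasDerivAt_right hii
    (hcont.stronglyMeasurableAtFilter isOpen_Ioi x hx)
    (hcont.continuousAt (Ioi_mem_nhds hx))
  refine hd.congr_of_eventuallyEq ?_
  filter_upwards [Ioi_mem_nhds hx] with y hy
  exact hk.integral_weightedPrimitive hlam hint hy

end IsDecayKernel

/-- Such an `f` is nondecreasing and bounded below, so it has a limit `b ≥ 0` at `0`; integrating
its derivative from `0` and exchanging the integrals gives the formula. -/
theorem IsDecayKernel.exists_eq_add_integral {k f : ℝ → ℝ} {lam c : ℝ} {κ : Measure ℝ} [SFinite κ]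
    (hk : IsDecayKernel k) (hlam : 0 < lam)
    (hint : ∀ x, 0 < x → IntegrableOn (fun t => k (x * t)) (Ioi 0) κ)
    (hf0 : ∀ x, 0 < x → 0 ≤ f x) (hc : 0 ≤ c)
    (hf : ∀ x, 0 < x → HasDerivAt f (x ^ (lam - 1) * (c + ∫ t in Ioi 0, k (x * t) ∂κ)) x) :
    ∃ b, 0 ≤ b ∧ ∀ x, 0 < x →
      IntegrableOn (fun t => weightedPrimitive lam k (x * t) / t ^ lam) (Ioi 0) κ ∧
      f x = c / lam * x ^ lam + b +
        ∫ t in Ioi 0, weightedPrimitive lam k (x * t) / t ^ lam ∂κ := by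
  have hd0 : ∀ x, 0 < x → 0 ≤ x ^ (lam - 1) * (c + ∫ t in Ioi 0, k (x * t) ∂κ) := fun x hx =>
    mul_nonneg (Real.rpow_nonneg hx.le _) (add_nonneg hc (hk.integral_nonneg hx))
  have hmono : MonotoneOn f (Ioi 0) := by
    refine monotoneOn_of_deriv_nonneg (convex_Ioi 0)
      (fun x hx => (hf x hx).continuousAt.continuousWithinAt) ?_ ?_ <;> rw [interior_Ioi]
    · exact fun x hx => (hf x hx).differentiableAt.differentiableWithinAt
    · intro x hx
      rw [(hf x hx).deriv]
      exact hd0 x hx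
  have hbdd : BddBelow (f '' Ioi 0) := ⟨0, by rintro _ ⟨x, hx, rfl⟩; exact hf0 x hx⟩
  have hlim := hmono.tendsto_nhdsGT hbdd
  set b := sInf (f '' Ioi 0) with hb
  refine ⟨b, Real.sInf_nonneg (by rintro _ ⟨x, hx, rfl⟩; exact hf0 x hx), fun x hx => ?_⟩
  set F := Function.update f 0 b with hF
  have hFe : ∀ y, 0 < y → F y = f y := fun y hy => Function.update_of_ne hy.ne' _ _
  have hFd : ∀ y, 0 < y →
      HasDerivAt F (y ^ (lam - 1) * (c + ∫ t in Ioi 0, k (y * t) ∂κ)) y := fun y hy =>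
    (hf y hy).congr_of_eventuallyEq (by
      filter_upwards [Ioi_mem_nhds hy] with z hz using hFe z hz)
  have hFc : ContinuousOn F (Icc 0 x) := by
    intro y hy
    rcases hy.1.eq_or_lt with h | h
    · subst h
      have : ContinuousWithinAt F (Ioi 0) 0 := by
        rw [ContinuousWithinAt, hF, Function.update_self]
        refine hlim.congr' ?_
        filter_upwards [self_mem_nhdsWithin] with y hy using (hFe y hy).symm
      exact (continuousWithinAt_Ioi_iff_Ici.1 this).mono Icc_subset_Ici_self
    · exact (hFd y h).continuousAt.continuousWithinAt
  -- Integrability near `0` is not assumed: it follows from the sign of the derivative and the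
  -- continuity of the extension `F` at `0`.
  have hI := intervalIntegral.integrableOn_deriv_of_nonneg hFc (fun y hy => hFd y hy.1)
    (fun y hy => hd0 y hy.1)
  have hII := (intervalIntegrable_iff_integrableOn_Ioc_of_le hx.le).2 hI
  have hFTC := intervalIntegral.integral_eq_sub_of_hasDerivAt_of_le hx.le hFc
    (fun y hy => hFd y hy.1) hII
  have hrp : IntervalIntegrable (fun y : ℝ => c * y ^ (lam - 1)) volume 0 x :=
    (intervalIntegral.intervalIntegrable_rpow' (by linarith)).const_mul c
  have hG : IntervalIntegrable (fun y => y ^ (lam - 1) * ∫ t in Ioi 0, k (y * t) ∂κ) volume 0 x :=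
    (hII.sub hrp).congr (fun y _ => by ring)
  refine ⟨(hk.integrableOn_weightedPrimitive_iff hlam hint hx).2
    ((intervalIntegrable_iff_integrableOn_Ioc_of_le hx.le).1 hG), ?_⟩
  rw [hk.integral_weightedPrimitive hlam hint hx]
  have e : ∫ y in (0 : ℝ)..x, y ^ (lam - 1) * (c + ∫ t in Ioi 0, k (y * t) ∂κ) =
      c / lam * x ^ lam + ∫ y in (0 : ℝ)..x, y ^ (lam - 1) * ∫ t in Ioi 0, k (y * t) ∂κ := by
    have : c / lam * x ^ lam = ∫ y in (0 : ℝ)..x, c * y ^ (lam - 1) := by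
      rw [intervalIntegral.integral_const_mul, integral_rpow (Or.inl (by linarith))]
      simp [Real.zero_rpow hlam.ne']
      ring
    rw [this, ← intervalIntegral.integral_add hrp hG]
    congr 1; ext y; ring
  rw [e, hFe x hx, show F 0 = b from Function.update_self _ _ _] at hFTC
  linarith

/-! ### The exponential kernel and Laplace transforms. -/

theorem isDecayKernel_exp_neg : IsDecayKernel (fun u => Real.exp (-u)) where
  measurable := by fun_prop
  continuousOn := by fun_prop
  antitoneOn := fun a _ b _ h => Real.exp_le_exp.2 (by linarith)
  nonneg := fun _ _ => (Real.exp_pos _).le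

/-- Laplace transforms are completely monotonic. -/
theorem completelyMonotonic_laplace {ν : Measure ℝ} (h0 : ∀ᵐ s ∂ν, 0 ≤ s)
    (hint : ∀ x, 0 < x → Integrable (fun s => Real.exp (-(x * s))) ν) :
    CompletelyMonotonic (fun x => ∫ s, Real.exp (-(x * s)) ∂ν) := by
  have hsub : ∀ x : ℝ, 0 < x →
      x ∈ interior (ProbabilityTheory.integrableExpSet (fun s : ℝ => -s) ν) := fun x hx =>
    interior_maximal (fun y hy => by
      have := hint y hy
      simp_rw [← mul_neg] at this
      exact this) isOpen_Ioi hx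
  have e : (fun x => ∫ s, Real.exp (-(x * s)) ∂ν) =
      ProbabilityTheory.mgf (fun s : ℝ => -s) ν := by
    ext x
    simp [ProbabilityTheory.mgf]
  rw [e]
  refine ⟨fun x hx => (ProbabilityTheory.analyticAt_mgf (hsub x hx)).contDiffAt.contDiffWithinAt,
    fun n x hx => ?_⟩
  rw [iteratedDerivWithin_of_isOpen isOpen_Ioi hx,
    ProbabilityTheory.iteratedDeriv_mgf (hsub x hx), ← integral_const_mul]
  refine integral_nonneg_of_ae ?_
  filter_upwards [h0] with s hs
  simp only [Pi.zero_apply]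
  rw [← mul_assoc, ← mul_pow, neg_one_mul, neg_neg]
  positivity

theorem CompletelyMonotonic.congr {f g : ℝ → ℝ} (hf : CompletelyMonotonic f)
    (h : ∀ x, 0 < x → g x = f x) : CompletelyMonotonic g := by
  refine ⟨hf.1.congr h, fun n x hx => ?_⟩
  rw [iteratedDerivWithin_congr (s := Ioi 0) (fun y hy => h y hy) hx]
  exact hf.2 n x hx

theorem CompletelyMonotonic.nonneg {f : ℝ → ℝ} (hf : CompletelyMonotonic f) {x : ℝ} (hx : 0 < x) :
    0 ≤ f x := by
  simpa using hf.2 0 x hx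

/-- The measures in the definitions are arbitrary, while Tonelli needs s-finiteness; the
integrability conditions supply it. -/
theorem sigmaFinite_of_integrable_pos {X : Type*} [MeasurableSpace X] {μ : Measure X} {f : X → ℝ}
    (hf : Integrable f μ) (h0 : ∀ᵐ x ∂μ, 0 < f x) : SigmaFinite μ := by
  obtain ⟨t, ht, h1, h2⟩ := hf.aefinStronglyMeasurable.exists_set_sigmaFinite
  have h3 : ∀ᵐ x ∂μ, x ∈ t := by
    have h4 := (ae_restrict_iff' ht.compl).1 h1
    filter_upwards [h0, h4] with x hx h5
    by_contra h
    exact hx.ne' (h5 h)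
  rwa [Measure.restrict_eq_self_of_ae_mem h3] at h2

/-! ### Thorin-Bernstein functions and generalized Stieltjes functions. -/

/-- The density `t^{lam-α} ∫ e^{-ts} dν(s)`. -/
def laplaceDensity (lam α : ℝ) (ν : Measure ℝ) (t : ℝ) : ENNReal :=
  ENNReal.ofReal (t ^ (lam - α)) * ∫⁻ s, ENNReal.ofReal (Real.exp (-(t * s))) ∂ν

theorem measurable_laplaceDensity (lam α : ℝ) (ν : Measure ℝ) [SFinite ν] :
    Measurable (laplaceDensity lam α ν) := by
  have : Measurable fun p : ℝ × ℝ => ENNReal.ofReal (Real.exp (-(p.1 * p.2))) := by fun_prop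
  exact (by fun_prop : Measurable fun t : ℝ => ENNReal.ofReal (t ^ (lam - α))).mul
    this.lintegral_prod_right'

/-- This puts integrals against `φ(t) dt` into the form `t^(-lam) dκ(t)` required by the kernel
lemmas, with `dκ = t^lam φ(t) dt` on `(0,∞)`. -/
theorem integral_div_withDensity {lam : ℝ} {d : ℝ → ENNReal} (hd : Measurable d) {φ : ℝ → ℝ}
    (hφ0 : ∀ t, 0 < t → 0 ≤ φ t) (hφ : ∀ t, 0 < t → d t = ENNReal.ofReal (t ^ lam * φ t))
    (F : ℝ → ℝ) :
    (IntegrableOn (fun t => F t / t ^ lam) (Ioi 0) (volume.withDensity d) ↔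
      IntegrableOn (fun t => F t * φ t) (Ioi 0)) ∧
    ∫ t in Ioi 0, F t / t ^ lam ∂(volume.withDensity d) = ∫ t in Ioi 0, F t * φ t := by
  have hfin : ∀ᵐ t ∂volume.restrict (Ioi (0 : ℝ)), d t < ⊤ :=
    (ae_restrict_iff' measurableSet_Ioi).2 (Eventually.of_forall fun t ht => by
      rw [hφ t ht]; exact ENNReal.ofReal_lt_top)
  have e : ∀ t ∈ Ioi (0 : ℝ), (d t).toReal • (F t / t ^ lam) = F t * φ t := fun t ht => by
    have ht : 0 < t := ht
    have h1 : 0 < t ^ lam := Real.rpow_pos_of_pos ht _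
    rw [hφ t ht, ENNReal.toReal_ofReal (mul_nonneg h1.le (hφ0 t ht)), smul_eq_mul]
    field_simp
  constructor
  · rw [IntegrableOn, restrict_withDensity measurableSet_Ioi,
      integrable_withDensity_iff_integrable_smul' hd hfin]
    exact integrableOn_congr_fun e measurableSet_Ioi
  · rw [restrict_withDensity measurableSet_Ioi,
      integral_withDensity_eq_integral_toReal_smul hd hfin]
    exact setIntegral_congr_fun measurableSet_Ioi e

/-- Tonelli and the Gamma integral of `t^(lam-α) e^(-(s+x)t)`, which converges at `0` because `α <
lam + 1`. -/
theorem lintegral_exp_laplaceDensity {lam α : ℝ} (hα : α < lam + 1) {ν : Measure ℝ} [SFinite ν]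
    (h0 : ∀ᵐ s ∂ν, 0 ≤ s) {x : ℝ} (hx : 0 < x) :
    ∫⁻ t in Ioi 0, ENNReal.ofReal (Real.exp (-(x * t)))
        ∂(volume.withDensity (laplaceDensity lam α ν)) =
      ∫⁻ s, ENNReal.ofReal (Real.Gamma (lam + 1 - α) * (1 / (s + x) ^ (lam + 1 - α))) ∂ν := by
  have hρ : 0 < lam + 1 - α := by linarith
  rw [restrict_withDensity measurableSet_Ioi,
    lintegral_withDensity_eq_lintegral_mul _ (measurable_laplaceDensity _ _ _) (by fun_prop)]
  have e1 : ∀ t ∈ Ioi (0 : ℝ), (laplaceDensity lam α ν * fun t =>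
      ENNReal.ofReal (Real.exp (-(x * t)))) t =
      ∫⁻ s, ENNReal.ofReal (t ^ (lam - α) * Real.exp (-((s + x) * t))) ∂ν := fun t ht => by
    simp only [Pi.mul_apply, laplaceDensity]
    rw [mul_assoc, mul_comm (lintegral _ _), ← lintegral_const_mul _ (by fun_prop),
      ← lintegral_const_mul _ (by fun_prop)]
    refine lintegral_congr fun s => ?_
    rw [← ENNReal.ofReal_mul (Real.exp_pos _).le,
      ← ENNReal.ofReal_mul (Real.rpow_nonneg (le_of_lt ht) _), ← Real.exp_add]
    congr 3; ring
  rw [setLIntegral_congr_fun measurableSet_Ioi e1, lintegral_lintegral_swap (by fun_prop)]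
  refine lintegral_congr_ae ?_
  filter_upwards [h0] with s hs
  have hr : 0 < s + x := by linarith
  have hI := Real.integral_rpow_mul_exp_neg_mul_Ioi hρ hr
  rw [show lam + 1 - α - 1 = lam - α by ring] at hI
  have hint : IntegrableOn (fun t : ℝ => t ^ (lam - α) * Real.exp (-((s + x) * t))) (Ioi 0) := by
    -- The integral has a known positive value, whereas a non-integrable function would have
    -- integral `0` by convention.
    by_contra h
    rw [integral_undef h] at hI
    have : 0 < (1 / (s + x)) ^ (lam + 1 - α) * Real.Gamma (lam + 1 - α) :=
      mul_pos (Real.rpow_pos_of_pos (by positivity) _) (Real.Gamma_pos_of_pos hρ)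
    linarith
  rw [← ofReal_integral_eq_lintegral_ofReal hint, hI, Real.div_rpow zero_le_one hr.le,
    Real.one_rpow, mul_comm]
  exact (ae_restrict_iff' measurableSet_Ioi).2 (Eventually.of_forall fun t ht =>
    mul_nonneg (Real.rpow_nonneg (le_of_lt ht) _) (Real.exp_pos _).le)

theorem IsThorinBernstein.isGenStieltjes {lam α : ℝ} (hlam : 0 < lam) (hα : α < lam + 1)
    {f : ℝ → ℝ} (hf : IsThorinBernstein lam α f) :
    DifferentiableOn ℝ f (Ioi 0) ∧
      IsGenStieltjes (lam + 1 - α) (fun x => x ^ (1 - lam) * deriv f x) := by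
  obtain ⟨a, b, φ, ha, -, hφ, hrep⟩ := hf
  obtain ⟨ν, hsf, h0, hν⟩ := CompletelyMonotonic.exists_measure_laplace hφ
  have hφ0 : ∀ t, 0 < t → 0 ≤ φ t := fun t ht =>
    nonneg_of_mul_nonneg_right (CompletelyMonotonic.nonneg hφ ht) (Real.rpow_pos_of_pos ht _)
  have hd : ∀ t, 0 < t → laplaceDensity lam α ν t = ENNReal.ofReal (t ^ lam * φ t) := fun t ht => by
    rw [laplaceDensity, hν t ht, ← ENNReal.ofReal_mul (Real.rpow_nonneg ht.le _), ← mul_assoc,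
      ← Real.rpow_add ht]
    congr 3; ring
  have hD := fun x : ℝ => integral_div_withDensity (measurable_laplaceDensity lam α ν) hφ0 hd
    (fun t => incompleteGamma lam (x * t))
  set κ := volume.withDensity (laplaceDensity lam α ν) with hκ
  have hI : ∀ x, 0 < x → IntegrableOn
      (fun t => weightedPrimitive lam (fun u => Real.exp (-u)) (x * t) / t ^ lam) (Ioi 0) κ :=
    fun x hx => (hD x).1.2 (hrep x hx).1
  have hk := isDecayKernel_exp_neg
  have hder : ∀ x, 0 < x → HasDerivAt f
      (a * (lam * x ^ (lam - 1)) + x ^ (lam - 1) * ∫ t in Ioi 0, Real.exp (-(x * t)) ∂κ) x := by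
    intro x hx
    have h1 := hk.hasDerivAt_integral_weightedPrimitive hlam hI hx
    have h2 := (((Real.hasDerivAt_rpow_const (p := lam) (Or.inl hx.ne')).const_mul a).add_const b).add h1
    refine h2.congr_of_eventuallyEq ?_
    filter_upwards [Ioi_mem_nhds hx] with y hy
    rw [(hrep y hy).2, ← (hD y).2]
    rfl
  refine ⟨fun x hx => (hder x hx).differentiableAt.differentiableWithinAt, ?_⟩
  have hΓ : 0 < Real.Gamma (lam + 1 - α) := Real.Gamma_pos_of_pos (by linarith)
  have hG : ∀ x, 0 < x →
      Integrable (fun s => Real.Gamma (lam + 1 - α) * (1 / (s + x) ^ (lam + 1 - α))) ν ∧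
      ∫ s, Real.Gamma (lam + 1 - α) * (1 / (s + x) ^ (lam + 1 - α)) ∂ν =
        ∫ t in Ioi 0, Real.exp (-(x * t)) ∂κ := fun x hx => by
    have h1 := hk.integrableOn_of_weightedPrimitive hlam hx (hI x hx)
    have h2 := hk.ofReal_integral hx h1
    rw [lintegral_exp_laplaceDensity hα h0 hx] at h2
    have h3 : 0 ≤ᵐ[ν] fun s => Real.Gamma (lam + 1 - α) * (1 / (s + x) ^ (lam + 1 - α)) := by
      filter_upwards [h0] with s hs
      have : 0 ≤ s + x := by linarith
      simp only [Pi.zero_apply]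
      positivity
    have hm : AEStronglyMeasurable
        (fun s => Real.Gamma (lam + 1 - α) * (1 / (s + x) ^ (lam + 1 - α))) ν :=
      (by fun_prop : Measurable
        fun s => Real.Gamma (lam + 1 - α) * (1 / (s + x) ^ (lam + 1 - α))).aestronglyMeasurable
    refine ⟨(lintegral_ofReal_ne_top_iff_integrable hm h3).1
      (by rw [← h2]; exact ENNReal.ofReal_ne_top), ?_⟩
    rw [integral_eq_lintegral_of_nonneg_ae h3 hm, ← h2,
      ENNReal.toReal_ofReal (hk.integral_nonneg hx)]
  have hres : ∀ c : ENNReal, (c • ν).restrict (Ici 0) = c • ν := fun c => by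
    rw [Measure.restrict_smul, Measure.restrict_eq_self_of_ae_mem (s := Ici 0) h0]
  refine ⟨lam * a, ENNReal.ofReal (Real.Gamma (lam + 1 - α)) • ν, by positivity, ?_, fun x hx => ?_⟩
  · rw [IntegrableOn, hres]
    refine Integrable.smul_measure ?_ ENNReal.ofReal_ne_top
    have := (hG 1 one_pos).1.const_mul (Real.Gamma (lam + 1 - α))⁻¹
    refine this.congr (Eventually.of_forall fun s => ?_)
    simp only [inv_mul_cancel_left₀ hΓ.ne', add_comm]
  · simp only
    rw [hres, (hder x hx).deriv, integral_smul_measure, ← (hG x hx).2,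
      integral_const_mul, smul_eq_mul, ENNReal.toReal_ofReal hΓ.le]
    have : x ^ (1 - lam) * x ^ (lam - 1) = 1 := by
      rw [← Real.rpow_add hx]; simp
    linear_combination (a * lam + Real.Gamma (lam + 1 - α) *
      ∫ t, 1 / (t + x) ^ (lam + 1 - α) ∂ν) * this

theorem exists_exp_le_div_rpow {ρ t : ℝ} (hρ : 0 < ρ) (ht : 0 < t) :
    ∃ C, ∀ s, 0 ≤ s → Real.exp (-(t * s)) ≤ C * (1 / (1 + s) ^ ρ) := by
  refine ⟨(ρ / |t|) ^ ρ * Real.exp t, fun s hs => ?_⟩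
  have h := ProbabilityTheory.rpow_abs_le_mul_exp_abs (1 + s) hρ.le ht.ne'
  have hs1 : 0 < 1 + s := by linarith
  rw [abs_of_pos hs1, abs_of_pos ht] at h
  have hp : 0 < (1 + s) ^ ρ := Real.rpow_pos_of_pos hs1 _
  rw [mul_one_div, le_div_iff₀ hp]
  calc Real.exp (-(t * s)) * (1 + s) ^ ρ
      ≤ Real.exp (-(t * s)) * ((ρ / t) ^ ρ * Real.exp (t * (1 + s))) := by gcongr
    _ = (ρ / t) ^ ρ * (Real.exp (-(t * s)) * Real.exp (t * (1 + s))) := by ring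
    _ = (ρ / |t|) ^ ρ * Real.exp t := by
      rw [← Real.exp_add, abs_of_pos ht]; congr 2; ring

theorem isThorinBernstein_of_isGenStieltjes {lam α : ℝ} (hlam : 0 < lam) (hα : α < lam + 1)
    {f : ℝ → ℝ} (hf0 : ∀ x, 0 < x → 0 ≤ f x) (hdiff : DifferentiableOn ℝ f (Ioi 0))
    (hS : IsGenStieltjes (lam + 1 - α) (fun x => x ^ (1 - lam) * deriv f x)) :
    IsThorinBernstein lam α f := by
  obtain ⟨c, μ, hc, hμ, hrep⟩ := hS
  have hρ : 0 < lam + 1 - α := by linarith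
  have hΓ : 0 < Real.Gamma (lam + 1 - α) := Real.Gamma_pos_of_pos hρ
  have hae : ∀ᵐ s ∂μ.restrict (Ici 0), 0 ≤ s := ae_restrict_mem measurableSet_Ici
  have hsig : SigmaFinite (μ.restrict (Ici 0)) := sigmaFinite_of_integrable_pos hμ (by
    filter_upwards [hae] with s hs
    have : 0 < 1 + s := by linarith
    positivity)
  -- Dividing by `Γ(lam+1-α)` cancels the factor produced by the Gamma integral.
  set ν := ENNReal.ofReal (Real.Gamma (lam + 1 - α))⁻¹ • μ.restrict (Ici 0) with hν
  have hνsf : SFinite ν := by rw [hν]; infer_instance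
  have h0 : ∀ᵐ s ∂ν, 0 ≤ s := Measure.ae_smul_measure hae _
  have hμ1 : Integrable (fun s => 1 / (1 + s) ^ (lam + 1 - α)) ν :=
    Integrable.smul_measure hμ ENNReal.ofReal_ne_top
  have hexp : ∀ t, 0 < t → Integrable (fun s => Real.exp (-(t * s))) ν := fun t ht => by
    obtain ⟨C, hC⟩ := exists_exp_le_div_rpow hρ ht
    refine (hμ1.const_mul C).mono' (by fun_prop) ?_
    filter_upwards [h0] with s hs
    rw [Real.norm_of_nonneg (Real.exp_pos _).le]
    exact hC s hs
  have hΦ := completelyMonotonic_laplace h0 hexp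
  set Φ : ℝ → ℝ := fun t => ∫ s, Real.exp (-(t * s)) ∂ν with hΦd
  have hφα : ∀ t, 0 < t → t ^ α * (t ^ (-α) * Φ t) = Φ t := fun t ht => by
    rw [← mul_assoc, ← Real.rpow_add ht, add_neg_cancel, Real.rpow_zero, one_mul]
  have hφ0 : ∀ t, 0 < t → 0 ≤ t ^ (-α) * Φ t := fun t ht =>
    mul_nonneg (Real.rpow_nonneg ht.le _) (hΦ.nonneg ht)
  have hd : ∀ t, 0 < t → laplaceDensity lam α ν t =
      ENNReal.ofReal (t ^ lam * (t ^ (-α) * Φ t)) := fun t ht => by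
    rw [laplaceDensity, ← mul_assoc, ← Real.rpow_add ht,
      ENNReal.ofReal_mul (Real.rpow_nonneg ht.le _), hΦd, ← sub_eq_add_neg,
      ofReal_integral_eq_lintegral_ofReal (hexp t ht)
        (Eventually.of_forall fun s => (Real.exp_pos _).le)]
  have hD := fun x : ℝ => integral_div_withDensity (measurable_laplaceDensity lam α ν) hφ0 hd
    (fun t => incompleteGamma lam (x * t))
  have hk := isDecayKernel_exp_neg
  have hS : ∀ x, 0 < x → Integrable (fun s => 1 / (s + x) ^ (lam + 1 - α)) (μ.restrict (Ici 0)) := by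
    intro x hx
    -- Chosen so that `1 + s ≤ m (s + x)` for all `s ≥ 0`.
    set m := max 1 (1 / x) with hm
    have hm0 : 0 < m := lt_max_of_lt_left one_pos
    refine (hμ.const_mul (m ^ (lam + 1 - α))).mono' ?_ ?_
    · exact (by fun_prop : Measurable
        fun s => 1 / (s + x) ^ (lam + 1 - α)).aestronglyMeasurable
    · filter_upwards [hae] with s hs
      have h1 : 0 < s + x := by linarith
      have h2 : 0 < 1 + s := by linarith
      rw [Real.norm_of_nonneg (by positivity), mul_one_div,
        div_le_div_iff₀ (by positivity) (by positivity), one_mul,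
        ← Real.mul_rpow hm0.le h1.le]
      refine Real.rpow_le_rpow h2.le ?_ hρ.le
      have h3 : 1 ≤ m := le_max_left _ _
      have h4 : 1 ≤ m * x := by
        rw [← div_le_iff₀ hx]; exact le_max_right _ _
      nlinarith
  have hG : ∀ x, 0 < x → IntegrableOn (fun t => Real.exp (-(x * t))) (Ioi 0)
        (volume.withDensity (laplaceDensity lam α ν)) ∧
      ∫ t in Ioi 0, Real.exp (-(x * t)) ∂(volume.withDensity (laplaceDensity lam α ν)) =
        ∫ s in Ici 0, 1 / (s + x) ^ (lam + 1 - α) ∂μ := fun x hx => by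
    have h1 := lintegral_exp_laplaceDensity hα h0 hx
    have h3 : 0 ≤ᵐ[μ.restrict (Ici 0)] fun s => 1 / (s + x) ^ (lam + 1 - α) := by
      filter_upwards [hae] with s hs
      have : 0 ≤ s + x := by linarith
      simp only [Pi.zero_apply]
      positivity
    have h2 : ∫⁻ s, ENNReal.ofReal (Real.Gamma (lam + 1 - α) * (1 / (s + x) ^ (lam + 1 - α))) ∂ν =
        ENNReal.ofReal (∫ s in Ici 0, 1 / (s + x) ^ (lam + 1 - α) ∂μ) := by
      rw [ofReal_integral_eq_lintegral_ofReal (hS x hx) h3, hν, lintegral_smul_measure]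
      simp_rw [ENNReal.ofReal_mul hΓ.le]
      rw [lintegral_const_mul _ (by fun_prop), smul_eq_mul, ← mul_assoc,
        ← ENNReal.ofReal_mul (by positivity), inv_mul_cancel₀ hΓ.ne', ENNReal.ofReal_one, one_mul]
    rw [h2] at h1
    have hnn : 0 ≤ᵐ[(volume.withDensity (laplaceDensity lam α ν)).restrict (Ioi 0)]
        fun t => Real.exp (-(x * t)) := Eventually.of_forall fun s => (Real.exp_pos _).le
    refine ⟨(lintegral_ofReal_ne_top_iff_integrable (by fun_prop) hnn).1
      (by rw [h1]; exact ENNReal.ofReal_ne_top), ?_⟩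
    rw [integral_eq_lintegral_of_nonneg_ae hnn (by fun_prop), h1,
      ENNReal.toReal_ofReal (integral_nonneg_of_ae h3)]
  obtain ⟨b, hb, hfin⟩ := hk.exists_eq_add_integral hlam (fun x hx => (hG x hx).1) hf0 hc
    (fun x hx => by
      have h1 := (hdiff.differentiableAt (Ioi_mem_nhds hx)).hasDerivAt
      refine h1.congr_deriv ?_
      have h2 := hrep x hx
      simp only at h2
      rw [(hG x hx).2, ← h2, ← mul_assoc, ← Real.rpow_add hx]
      simp)
  refine ⟨c / lam, b, fun t => t ^ (-α) * Φ t, by positivity, hb, hΦ.congr hφα, fun x hx => ?_⟩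
  obtain ⟨i, e⟩ := hfin x hx
  refine ⟨(hD x).1.1 i, ?_⟩
  rw [e, ← (hD x).2]
  rfl

/-! ### The Beta kernel and its uniform bounds. -/

/-- The kernel `(1 + u/n)^{-(n+lam)}`, an approximation of `e^{-u}`. -/
def betaKernel (lam : ℝ) (n : ℕ) (u : ℝ) : ℝ := (1 + u / n) ^ (-(n + lam))

theorem isDecayKernel_betaKernel {lam : ℝ} (hlam : 0 < lam) (n : ℕ) :
    IsDecayKernel (betaKernel lam n) where
  measurable := by unfold betaKernel; fun_prop
  continuousOn := by
    refine ContinuousOn.rpow_const (by fun_prop) fun u hu => Or.inl ?_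
    have hu : 0 ≤ u := hu
    positivity
  antitoneOn := fun u hu v hv h => by
    have hu : 0 ≤ u := hu
    refine Real.rpow_le_rpow_of_nonpos (by positivity) (by gcongr) ?_
    have := n.cast_nonneg (α := ℝ)
    linarith
  nonneg := fun u hu => Real.rpow_nonneg (by positivity) _

/-- The substitution `t = u/(u+n)`, with `1 - t = n/(u+n)` and `dt = n/(u+n)^2 du`. -/
theorem incompleteBeta_eq {lam : ℝ} (hlam : 0 < lam) {n : ℕ} (hn : 1 ≤ n) {y : ℝ} (hy : 0 < y) :
    incompleteBeta lam n (y / (y + n)) =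
      (n : ℝ) ^ (-lam) * weightedPrimitive lam (betaKernel lam n) y := by
  have hN : (0 : ℝ) < n := by exact_mod_cast hn
  set N : ℝ := (n : ℝ) with hNdef
  have hsub : ∀ u ∈ Icc 0 y, 0 ≤ u / (u + N) ∧ u / (u + N) ≤ y / (y + N) := fun u hu => by
    have h1 : 0 < u + N := by linarith [hu.1]
    refine ⟨div_nonneg hu.1 h1.le, ?_⟩
    rw [div_le_div_iff₀ h1 (by linarith)]
    nlinarith [hu.2]
  have hlt : y / (y + N) < 1 := by rw [div_lt_one (by linarith)]; linarith
  have e : ∀ u ∈ Icc 0 y, (u / (u + N)) ^ (lam - 1) * (1 - u / (u + N)) ^ (N - 1) *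
      (N / (u + N) ^ 2) = N ^ (-lam) * (u ^ (lam - 1) * betaKernel lam n u) := fun u hu => by
    have hA : 0 < u + N := by linarith [hu.1]
    have e1 : 1 - u / (u + N) = N / (u + N) := by field_simp; ring
    have e2 : 1 + u / N = (u + N) / N := by field_simp; ring
    rw [betaKernel, ← hNdef, e1, e2, Real.div_rpow hu.1 hA.le, Real.div_rpow hN.le hA.le,
      Real.div_rpow hA.le hN.le, Real.rpow_neg hN.le, Real.rpow_neg hN.le, Real.rpow_neg hA.le,
      Real.rpow_sub_one hA.ne' lam, Real.rpow_sub_one hN.ne', Real.rpow_sub_one hA.ne',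
      Real.rpow_add hA, Real.rpow_add hN]
    have a1 := (Real.rpow_pos_of_pos hA lam).ne'
    have a2 := (Real.rpow_pos_of_pos hA N).ne'
    have a3 := (Real.rpow_pos_of_pos hN lam).ne'
    have a4 := (Real.rpow_pos_of_pos hN N).ne'
    field_simp
  have hW := (isDecayKernel_betaKernel hlam n).intervalIntegrable hlam hy.le 1 zero_le_one
  simp only [mul_one] at hW
  have h := intervalIntegral.integral_comp_mul_deriv''' (a := 0) (b := y)
    (f := fun u => u / (u + N)) (f' := fun u => N / (u + N) ^ 2)
    (g := fun t => t ^ (lam - 1) * (1 - t) ^ (N - 1)) ?_ ?_ ?_ ?_ ?_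
  · rw [zero_div] at h
    rw [incompleteBeta, ← h, weightedPrimitive, ← intervalIntegral.integral_const_mul]
    refine intervalIntegral.integral_congr fun u hu => ?_
    rw [uIcc_of_le hy.le] at hu
    exact e u hu
  · rw [uIcc_of_le hy.le]
    exact ContinuousOn.div (by fun_prop) (by fun_prop) fun u hu => by linarith [hu.1]
  · intro u hu
    rw [min_eq_left hy.le, max_eq_right hy.le] at hu
    have hA : u + N ≠ 0 := by linarith [hu.1]
    refine HasDerivAt.hasDerivWithinAt
      (((hasDerivAt_id u).div ((hasDerivAt_id u).add_const N) hA).congr_deriv ?_)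
    simp
  · rw [min_eq_left hy.le, max_eq_right hy.le]
    rintro _ ⟨u, hu, rfl⟩
    have hpos : 0 < u / (u + N) := div_pos hu.1 (by linarith [hu.1])
    have hlt' := (hsub u ⟨hu.1.le, hu.2.le⟩).2.trans_lt hlt
    refine ContinuousAt.continuousWithinAt (ContinuousAt.mul ?_ ?_)
    · exact continuousAt_id.rpow_const (Or.inl hpos.ne')
    · exact (by fun_prop : ContinuousAt (fun t : ℝ => 1 - t) _).rpow_const
        (Or.inl (by simp only; linarith))
  · have hy' : 0 ≤ y / (y + N) := by positivity
    have h1 : IntervalIntegrable (fun t : ℝ => t ^ (lam - 1) * (1 - t) ^ (N - 1)) volume 0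
        (y / (y + N)) := by
      refine (intervalIntegral.intervalIntegrable_rpow' (by linarith)).mul_continuousOn ?_
      rw [uIcc_of_le hy']
      exact ContinuousOn.rpow_const (by fun_prop) fun t ht => Or.inl (by linarith [ht.2])
    refine ((intervalIntegrable_iff_integrableOn_Icc_of_le hy').1 h1).mono_set ?_
    rw [uIcc_of_le hy.le]
    rintro _ ⟨u, hu, rfl⟩
    exact hsub u hu
  · rw [uIcc_of_le hy.le]
    refine IntegrableOn.congr_fun
      (((intervalIntegrable_iff_integrableOn_Icc_of_le hy.le).1 hW).const_mul (N ^ (-lam)))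
      (fun u hu => (e u hu).symm) measurableSet_Icc

theorem betaIntegrand_eq {lam : ℝ} (hlam : 0 < lam) {n : ℕ} (hn : 1 ≤ n) {x t : ℝ} (hx : 0 < x)
    (ht : 0 < t) :
    betaIntegrand lam n x t =
      (n : ℝ) ^ (-lam) * (weightedPrimitive lam (betaKernel lam n) (x * t) / t ^ lam) := by
  have : x / (x + n / t) = x * t / (x * t + n) := by
    field_simp
  rw [betaIntegrand, this, incompleteBeta_eq hlam hn (mul_pos hx ht), mul_div_assoc]

/-- Bernoulli's inequality with exponent `(n+lam)/(1+lam) ≥ 1`. The exponent `1+lam` of the majorant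
is chosen so that its weighted primitive is explicit. -/
theorem betaKernel_le {lam : ℝ} (hlam : 0 < lam) {n : ℕ} (hn : 1 ≤ n) {u : ℝ} (hu : 0 ≤ u) :
    betaKernel lam n u ≤ (1 + u / (1 + lam)) ^ (-(1 + lam)) := by
  have hN : (1 : ℝ) ≤ n := by exact_mod_cast hn
  have hc : 0 < 1 + lam := by linarith
  have hun : 0 ≤ u / n := by positivity
  have h1 : 1 + u / (1 + lam) ≤ (1 + u / n) ^ ((n + lam) / (1 + lam)) := by
    refine le_trans ?_ (one_add_mul_self_le_rpow_one_add (by linarith)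
      (by rw [le_div_iff₀ hc]; linarith))
    have : (n + lam) / (1 + lam) * (u / n) = u / (1 + lam) * ((n + lam) / n) := by field_simp
    rw [this]
    have h2 : 1 ≤ (n + lam) / n := by rw [le_div_iff₀ (by linarith)]; linarith
    have : 0 ≤ u / (1 + lam) := by positivity
    nlinarith
  have h3 := Real.rpow_le_rpow_of_nonpos (by positivity) h1 (by linarith : -(1 + lam) ≤ 0)
  rw [← Real.rpow_mul (by positivity)] at h3
  rw [betaKernel]
  convert h3 using 2
  field_simp

theorem weightedPrimitive_betaKernel_le {lam : ℝ} (hlam : 0 < lam) {n : ℕ} (hn : 1 ≤ n) {y : ℝ}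
    (hy : 0 ≤ y) :
    weightedPrimitive lam (betaKernel lam n) y ≤ (y / (1 + y / (1 + lam))) ^ lam / lam := by
  have hc : 0 < 1 + lam := by linarith
  have hpos : ∀ u : ℝ, 0 ≤ u → 0 < 1 + u / (1 + lam) := fun u hu => by positivity
  have hI : IntervalIntegrable
      (fun u : ℝ => u ^ (lam - 1) * (1 + u / (1 + lam)) ^ (-(1 + lam))) volume 0 y := by
    refine (intervalIntegral.intervalIntegrable_rpow' (by linarith)).mul_continuousOn ?_
    rw [uIcc_of_le hy]
    exact ContinuousOn.rpow_const (by fun_prop) fun t ht => Or.inl (hpos t ht.1).ne'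
  have hW := (isDecayKernel_betaKernel hlam n).intervalIntegrable hlam hy 1 zero_le_one
  simp only [mul_one] at hW
  have h := intervalIntegral.integral_eq_sub_of_hasDerivAt_of_le hy
    (f := fun u => (u / (1 + u / (1 + lam))) ^ lam / lam) ?_ (fun u hu => ?_) hI
  · calc weightedPrimitive lam (betaKernel lam n) y
        ≤ ∫ u in (0 : ℝ)..y, u ^ (lam - 1) * (1 + u / (1 + lam)) ^ (-(1 + lam)) :=
          intervalIntegral.integral_mono_on hy hW hI fun u hu =>
            mul_le_mul_of_nonneg_left (betaKernel_le hlam hn hu.1) (Real.rpow_nonneg hu.1 _)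
      _ = _ := by
          rw [h]
          simp [Real.zero_rpow hlam.ne']
  · refine ContinuousOn.div_const (ContinuousOn.rpow_const ?_ fun u _ => Or.inr hlam.le) _
    exact ContinuousOn.div (by fun_prop) (by fun_prop) fun u hu => (hpos u hu.1).ne'
  · have hp := hpos u hu.1.le
    have h1 : HasDerivAt (fun u : ℝ => u / (1 + u / (1 + lam)))
        (1 / (1 + u / (1 + lam)) ^ 2) u := by
      have := (hasDerivAt_id u).div (((hasDerivAt_id u).div_const (1 + lam)).const_add 1) hp.ne'
      refine this.congr_deriv ?_
      simp only [id]
      congr 1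
      ring
    have h2 := (h1.rpow_const (p := lam) (Or.inl (div_pos hu.1 hp).ne')).div_const lam
    refine h2.congr_deriv ?_
    rw [Real.div_rpow hu.1.le hp.le, Real.rpow_neg hp.le, Real.rpow_add hp,
      Real.rpow_sub_one hp.ne', Real.rpow_one]
    have := (Real.rpow_pos_of_pos hp lam).ne'
    field_simp

/-- The bound is free of `n` and integrable by the condition on the triple, so it serves both
convergence of the integrals and domination in the limit. -/
theorem weightedPrimitive_betaKernel_div_le {lam : ℝ} (hlam : 0 < lam) {n : ℕ} (hn : 1 ≤ n)
    {x t : ℝ} (hx : 0 < x) (ht : 0 < t) :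
    weightedPrimitive lam (betaKernel lam n) (x * t) / t ^ lam ≤
      (x + 1 + lam) ^ lam / lam * (1 / (t + 1) ^ lam) := by
  have h := weightedPrimitive_betaKernel_le hlam hn (mul_pos hx ht).le
  have hp : 0 < 1 + x * t / (1 + lam) := by positivity
  have h1 : x * t / (1 + x * t / (1 + lam)) ≤ t * ((x + 1 + lam) / (t + 1)) := by
    rw [mul_comm x t, mul_div_assoc]
    refine mul_le_mul_of_nonneg_left ?_ ht.le
    rw [div_le_div_iff₀ (by rwa [mul_comm t x]) (by linarith)]
    have e : (x + 1 + lam) * (1 + t * x / (1 + lam)) =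
      x * (t + 1) + ((1 + lam) + x * (t * x / (1 + lam))) := by field_simp; ring
    rw [e]
    have : 0 ≤ (1 + lam) + x * (t * x / (1 + lam)) := by positivity
    linarith
  have h2 := Real.rpow_le_rpow (by positivity) h1 hlam.le
  rw [Real.mul_rpow ht.le (by positivity),
    Real.div_rpow (y := t + 1) (by positivity) (by positivity)] at h2
  rw [div_le_iff₀ (Real.rpow_pos_of_pos ht _)]
  calc _ ≤ _ := h
    _ ≤ (t ^ lam * ((x + 1 + lam) ^ lam / (t + 1) ^ lam)) / lam := by gcongr
    _ = _ := by ring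

/-- On `[0,1]` the exponential is at least `e^(-1)`, and `min t 1 ≥ t/(t+1)`. This yields the
integrability condition on the measure of a triple from convergence at `x = 1`. -/
theorem one_div_rpow_le_weightedPrimitive_exp {lam : ℝ} (hlam : 0 < lam) {t : ℝ} (ht : 0 < t) :
    1 / (t + 1) ^ lam ≤ Real.exp 1 * lam *
      (weightedPrimitive lam (fun u => Real.exp (-u)) (1 * t) / t ^ lam) := by
  have hk := isDecayKernel_exp_neg
  rw [one_mul]
  have hI : ∀ y, 0 ≤ y → IntervalIntegrable (fun u : ℝ => u ^ (lam - 1) * Real.exp (-u))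
      volume 0 y := fun y hy => by
    simpa using hk.intervalIntegrable hlam hy 1 zero_le_one
  have h1 : ∀ y, 0 ≤ y → y ≤ 1 →
      Real.exp (-1) * (y ^ lam / lam) ≤ weightedPrimitive lam (fun u => Real.exp (-u)) y :=
    fun y hy hy1 => by
      have e : Real.exp (-1) * (y ^ lam / lam) =
          ∫ u in (0 : ℝ)..y, u ^ (lam - 1) * Real.exp (-1) := by
        rw [intervalIntegral.integral_mul_const, integral_rpow (Or.inl (by linarith))]
        simp [Real.zero_rpow hlam.ne', mul_comm]
      rw [e]
      refine intervalIntegral.integral_mono_on hy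
        ((intervalIntegral.intervalIntegrable_rpow' (by linarith)).mul_const _) (hI y hy)
        fun u hu => ?_
      exact mul_le_mul_of_nonneg_left (Real.exp_le_exp.2 (by linarith [hu.2]))
        (Real.rpow_nonneg hu.1 _)
  have hmin : 0 ≤ min t 1 := le_min ht.le zero_le_one
  have h2 : weightedPrimitive lam (fun u => Real.exp (-u)) (min t 1) ≤
      weightedPrimitive lam (fun u => Real.exp (-u)) t := by
    refine intervalIntegral.integral_mono_interval le_rfl hmin (min_le_left _ _) ?_ (hI t ht.le)
    refine (ae_restrict_iff' measurableSet_Ioc).2 (Eventually.of_forall fun u hu => ?_)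
    exact mul_nonneg (Real.rpow_nonneg hu.1.le _) (Real.exp_pos _).le
  have h3 := (h1 _ hmin (min_le_right _ _)).trans h2
  have h4 : t / (t + 1) ≤ min t 1 := by
    refine le_min ?_ ?_
    · rw [div_le_iff₀ (by linarith)]; nlinarith
    · rw [div_le_one (by linarith)]; linarith
  have h5 := Real.rpow_le_rpow (by positivity) h4 hlam.le
  rw [Real.div_rpow ht.le (by linarith)] at h5
  have ht' : 0 < t ^ lam := Real.rpow_pos_of_pos ht _
  rw [← mul_div_assoc, le_div_iff₀ ht']
  calc 1 / (t + 1) ^ lam * t ^ lam = t ^ lam / (t + 1) ^ lam := by ring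
    _ ≤ min t 1 ^ lam := h5
    _ = Real.exp 1 * lam * (Real.exp (-1) * (min t 1 ^ lam / lam)) := by
        rw [Real.exp_neg]; field_simp
    _ ≤ _ := by gcongr

theorem tendsto_betaKernel (lam : ℝ) (u : ℝ) (hu : 0 ≤ u) :
    Tendsto (fun n => betaKernel lam n u) atTop (𝓝 (Real.exp (-u))) := by
  have h1 : Tendsto (fun n : ℕ => (1 + u / (n : ℝ)) ^ n) atTop (𝓝 (Real.exp u)) :=
    Real.tendsto_one_add_div_pow_exp u
  have h2 : Tendsto (fun n : ℕ => (1 + u / (n : ℝ)) ^ lam) atTop (𝓝 1) := by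
    have : Tendsto (fun n : ℕ => 1 + u / (n : ℝ)) atTop (𝓝 1) := by
      simpa using (tendsto_const_div_atTop_nhds_zero_nat u).const_add 1
    simpa using this.rpow_const (p := lam) (Or.inl one_ne_zero)
  have h3 := (h1.mul h2).inv₀ (by positivity)
  rw [mul_one, ← Real.exp_neg] at h3
  refine h3.congr fun n => ?_
  have hp : 0 < 1 + u / (n : ℝ) := by positivity
  rw [betaKernel, Real.rpow_neg hp.le, Real.rpow_add hp, Real.rpow_natCast]

theorem tendsto_weightedPrimitive_betaKernel {lam : ℝ} (hlam : 0 < lam) {y : ℝ} (hy : 0 ≤ y) :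
    Tendsto (fun n => weightedPrimitive lam (betaKernel lam n) y) atTop
      (𝓝 (weightedPrimitive lam (fun u => Real.exp (-u)) y)) := by
  refine intervalIntegral.tendsto_integral_filter_of_dominated_convergence
    (fun u => u ^ (lam - 1)) ?_ ?_ (intervalIntegral.intervalIntegrable_rpow' (by linarith)) ?_
  · refine Eventually.of_forall fun n => Measurable.aestronglyMeasurable ?_
    have := (isDecayKernel_betaKernel hlam n).measurable
    fun_prop
  · refine Eventually.of_forall fun n => Eventually.of_forall fun u hu => ?_
    rw [uIoc_of_le hy] at hu
    have hk := isDecayKernel_betaKernel hlam n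
    have h0 := Real.rpow_nonneg hu.1.le (lam - 1)
    rw [Real.norm_of_nonneg (mul_nonneg h0 (hk.nonneg _ hu.1.le))]
    have : betaKernel lam n u ≤ betaKernel lam n 0 :=
      hk.antitoneOn (mem_Ici.2 le_rfl) (mem_Ici.2 hu.1.le) hu.1.le
    have e : betaKernel lam n 0 = 1 := by simp [betaKernel]
    rw [e] at this
    nlinarith
  · refine Eventually.of_forall fun u hu => ?_
    rw [uIoc_of_le hy] at hu
    exact (tendsto_betaKernel lam u hu.1.le).const_mul _

/-! ### Asymptotics of the Gamma ratio. -/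

theorem prod_add_natCast_eq_Gamma {lam : ℝ} (hlam : 0 < lam) (n : ℕ) :
    (∏ j ∈ Finset.range n, (lam + j)) * Real.Gamma lam = Real.Gamma (lam + n) := by
  induction n with
  | zero => simp
  | succ n ih =>
    rw [Finset.prod_range_succ, mul_right_comm, ih]
    push_cast
    rw [← add_assoc, Real.Gamma_add_one (by positivity), mul_comm]

theorem tendsto_Gamma_ratio {lam : ℝ} (hlam : 0 < lam) :
    Tendsto (fun n : ℕ => Real.Gamma (lam + n) / Real.Gamma n * (n : ℝ) ^ (-lam)) atTop (𝓝 1) := by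
  have hΓ := (Real.Gamma_pos_of_pos hlam).ne'
  have h1 := (Real.GammaSeq_tendsto_Gamma lam).inv₀ hΓ
  -- Euler's product in `GammaSeq` has the extra factor `lam + n` and `n!` in place of `Γ(n)`; this
  -- ratio corrects both.
  have h2 : Tendsto (fun n : ℕ => (n : ℝ) / (n + lam)) atTop (𝓝 1) :=
    tendsto_natCast_div_add_atTop lam
  have h3 := (h1.mul h2).const_mul (Real.Gamma lam)
  rw [mul_one, mul_inv_cancel₀ hΓ] at h3
  refine h3.congr' ?_
  filter_upwards [eventually_ge_atTop 1] with n hn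
  have hN : (0 : ℝ) < n := by exact_mod_cast hn
  have hp := prod_add_natCast_eq_Gamma hlam n
  have hf : Real.Gamma (n + 1) = n.factorial := Real.Gamma_nat_eq_factorial n
  rw [Real.Gamma_add_one hN.ne'] at hf
  rw [Real.GammaSeq, Finset.prod_range_succ, ← hf, ← hp, Real.rpow_neg hN.le]
  have hP : 0 < ∏ j ∈ Finset.range n, (lam + j) := Finset.prod_pos fun j _ => by positivity
  have hΓn := (Real.Gamma_pos_of_pos hN).ne'
  have hr := (Real.rpow_pos_of_pos hN lam).ne'
  have : lam + (n : ℝ) ≠ 0 := by positivity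
  have : (n : ℝ) + lam ≠ 0 := by positivity
  field_simp
  ring

/-! ### Existence of triples, and the approximants. -/

theorem IsGenBernstein.exists_triple {lam : ℝ} (hlam : 0 < lam) {f : ℝ → ℝ}
    (hf : IsGenBernstein lam f) :
    ∃ (a b : ℝ) (μ : Measure ℝ), CorrespondsToTriple lam a b μ f := by
  obtain ⟨hf0, hfs, hcm⟩ := hf
  obtain ⟨ν, hsf, h0, hν⟩ := hcm.exists_measure_laplace
  have hk := isDecayKernel_exp_neg
  have hint : ∀ x, 0 < x → Integrable (fun s => Real.exp (-(x * s))) ν := fun x hx =>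
    (lintegral_ofReal_ne_top_iff_integrable (by fun_prop)
      (Eventually.of_forall fun s => (Real.exp_pos _).le)).1
      (by rw [hν x hx]; exact ENNReal.ofReal_ne_top)
  -- The atom of `ν` at `0` is split off: it produces the term `a x^lam` with `a = ν{0}/lam`.
  have hval : ∀ x, 0 < x → deriv f x * x ^ (1 - lam) =
      ν.real {0} + ∫ t in Ioi 0, Real.exp (-(x * t)) ∂ν := fun x hx => by
    have h1 : deriv f x * x ^ (1 - lam) = ∫ s, Real.exp (-(x * s)) ∂ν := by
      rw [integral_eq_lintegral_of_nonneg_ae (Eventually.of_forall fun s => (Real.exp_pos _).le)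
        (by fun_prop), hν x hx, ENNReal.toReal_ofReal (hcm.nonneg hx)]
    have h2 : ∫ s, Real.exp (-(x * s)) ∂ν = ∫ s in {0} ∪ Ioi 0, Real.exp (-(x * s)) ∂ν := by
      rw [Measure.restrict_eq_self_of_ae_mem]
      filter_upwards [h0] with s hs
      rcases hs.eq_or_lt with h | h
      · exact Or.inl h.symm
      · exact Or.inr h
    rw [h1, h2, setIntegral_union (by simp) measurableSet_Ioi (hint x hx).integrableOn
      (hint x hx).integrableOn, integral_singleton]
    simp
  obtain ⟨b, hb, hfin⟩ := hk.exists_eq_add_integral hlam (fun x hx => (hint x hx).integrableOn)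
    hf0 (measureReal_nonneg (μ := ν) (s := {0})) (fun x hx => by
      have h1 := ((hfs.differentiableOn (by simp)).differentiableAt (Ioi_mem_nhds hx)).hasDerivAt
      refine h1.congr_deriv ?_
      rw [← hval x hx, mul_comm (deriv f x), ← mul_assoc, ← Real.rpow_add hx]
      simp)
  refine ⟨ν.real {0} / lam, b, ν, by positivity, hb, ?_, fun x hx => (hfin x hx).2⟩
  refine ((hfin 1 one_pos).1.const_mul (Real.exp 1 * lam)).mono'
    (by fun_prop : Measurable fun t : ℝ => 1 / (t + 1) ^ lam).aestronglyMeasurable ?_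
  refine (ae_restrict_iff' measurableSet_Ioi).2 (Eventually.of_forall fun t ht => ?_)
  have ht : 0 < t := ht
  rw [Real.norm_of_nonneg (by positivity)]
  exact one_div_rpow_le_weightedPrimitive_exp hlam ht

variable {lam : ℝ} {μ : Measure ℝ}

theorem integrableOn_weightedPrimitive_betaKernel (hlam : 0 < lam)
    (hμ : IntegrableOn (fun t => 1 / (t + 1) ^ lam) (Ioi 0) μ) {n : ℕ} (hn : 1 ≤ n) {x : ℝ}
    (hx : 0 < x) :
    IntegrableOn (fun t => weightedPrimitive lam (betaKernel lam n) (x * t) / t ^ lam)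
      (Ioi 0) μ := by
  have hk := isDecayKernel_betaKernel hlam n
  refine (hμ.const_mul ((x + 1 + lam) ^ lam / lam)).mono'
    (hk.aestronglyMeasurable_weightedPrimitive hlam μ hx) ?_
  refine (ae_restrict_iff' measurableSet_Ioi).2 (Eventually.of_forall fun t ht => ?_)
  rw [Real.norm_of_nonneg (hk.weightedPrimitive_div_nonneg hx ht)]
  exact weightedPrimitive_betaKernel_div_le hlam hn hx ht

theorem integrableOn_betaIntegrand (hlam : 0 < lam)
    (hμ : IntegrableOn (fun t => 1 / (t + 1) ^ lam) (Ioi 0) μ) {n : ℕ} (hn : 1 ≤ n) {x : ℝ}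
    (hx : 0 < x) : IntegrableOn (betaIntegrand lam n x) (Ioi 0) μ :=
  IntegrableOn.congr_fun
    ((integrableOn_weightedPrimitive_betaKernel hlam hμ hn hx).const_mul ((n : ℝ) ^ (-lam)))
    (fun _ ht => (betaIntegrand_eq hlam hn hx ht).symm) measurableSet_Ioi

theorem betaApprox_eq (hlam : 0 < lam) (a b : ℝ) (μ : Measure ℝ) {n : ℕ} (hn : 1 ≤ n) {x : ℝ}
    (hx : 0 < x) :
    betaApprox lam a b μ n x = a * x ^ lam + b +
      Real.Gamma (lam + n) / Real.Gamma n * (n : ℝ) ^ (-lam) *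
        ∫ t in Ioi 0, weightedPrimitive lam (betaKernel lam n) (x * t) / t ^ lam ∂μ := by
  rw [betaApprox, setIntegral_congr_fun measurableSet_Ioi
    (fun t ht => betaIntegrand_eq hlam hn hx ht), integral_const_mul, mul_assoc]

theorem tendsto_betaApprox (hlam : 0 < lam) {a b : ℝ} {f : ℝ → ℝ}
    (h : CorrespondsToTriple lam a b μ f) {x : ℝ} (hx : 0 < x) :
    Tendsto (fun n : ℕ => betaApprox lam a b μ n x) atTop (𝓝 (f x)) := by
  obtain ⟨-, -, hμ, hf⟩ := h
  have h1 : Tendsto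
      (fun n => ∫ t in Ioi 0, weightedPrimitive lam (betaKernel lam n) (x * t) / t ^ lam ∂μ) atTop
      (𝓝 (∫ t in Ioi 0, weightedPrimitive lam (fun u => Real.exp (-u)) (x * t) / t ^ lam ∂μ)) := by
    refine tendsto_integral_filter_of_dominated_convergence
      (fun t => (x + 1 + lam) ^ lam / lam * (1 / (t + 1) ^ lam)) ?_ ?_ (hμ.const_mul _) ?_
    · exact Eventually.of_forall fun n =>
        (isDecayKernel_betaKernel hlam n).aestronglyMeasurable_weightedPrimitive hlam μ hx
    · filter_upwards [eventually_ge_atTop 1] with n hn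
      refine (ae_restrict_iff' measurableSet_Ioi).2 (Eventually.of_forall fun t ht => ?_)
      rw [Real.norm_of_nonneg
        ((isDecayKernel_betaKernel hlam n).weightedPrimitive_div_nonneg hx ht)]
      exact weightedPrimitive_betaKernel_div_le hlam hn hx ht
    · refine (ae_restrict_iff' measurableSet_Ioi).2 (Eventually.of_forall fun t ht => ?_)
      exact (tendsto_weightedPrimitive_betaKernel hlam (mul_pos hx ht).le).div_const _
  have h2 := ((tendsto_Gamma_ratio hlam).mul h1).const_add (a * x ^ lam + b)
  rw [one_mul] at h2
  rw [hf x hx]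
  refine h2.congr' ?_
  filter_upwards [eventually_ge_atTop 1] with n hn
  exact (betaApprox_eq hlam a b μ hn hx).symm

theorem betaKernel_eq_div {n : ℕ} (hn : 1 ≤ n) {x t : ℝ} (hx : 0 < x) (ht : 0 < t) :
    betaKernel lam n (x * t) = (n / t) ^ (n + lam) * (1 / (n / t + x) ^ (n + lam)) := by
  have hN : (0 : ℝ) < n := by exact_mod_cast hn
  have e : 1 + x * t / n = (n / t + x) / (n / t) := by field_simp
  rw [betaKernel, e, Real.rpow_neg (by positivity),
    Real.div_rpow (by positivity) (by positivity), inv_div, mul_one_div]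

theorem exists_isThorinBernstein_betaApprox (hlam : 0 < lam) {a b : ℝ} (ha : 0 ≤ a) (hb : 0 ≤ b)
    (hμ : IntegrableOn (fun t => 1 / (t + 1) ^ lam) (Ioi 0) μ) {n : ℕ} (hn : 1 ≤ n) :
    ∃ α : ℝ, α < lam + 1 ∧ IsThorinBernstein lam α (betaApprox lam a b μ n) := by
  have hN : (0 : ℝ) < n := by exact_mod_cast hn
  have hk := isDecayKernel_betaKernel hlam n
  have hae : ∀ᵐ t ∂μ.restrict (Ioi 0), 0 < t := ae_restrict_mem measurableSet_Ioi
  have hsig : SigmaFinite (μ.restrict (Ioi 0)) := sigmaFinite_of_integrable_pos hμ (by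
    filter_upwards [hae] with t ht
    positivity)
  -- Only the restriction of `μ` is known to be σ-finite, so the kernel lemmas are applied to it and
  -- the double restriction is collapsed.
  have hrr : (μ.restrict (Ioi 0)).restrict (Ioi 0) = μ.restrict (Ioi 0) := by simp
  set c := Real.Gamma (lam + n) / Real.Gamma n * (n : ℝ) ^ (-lam) with hc
  have hc0 : 0 < c := by
    have h1 := Real.Gamma_pos_of_pos hN
    have h2 := Real.Gamma_pos_of_pos (by positivity : 0 < lam + n)
    positivity
  have hW : ∀ x, 0 < x →
      IntegrableOn (fun t => weightedPrimitive lam (betaKernel lam n) (x * t) / t ^ lam) (Ioi 0)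
        (μ.restrict (Ioi 0)) := fun x hx => by
    rw [IntegrableOn, hrr]
    exact integrableOn_weightedPrimitive_betaKernel hlam hμ hn hx
  have hK : ∀ x, 0 < x → Integrable (fun t => betaKernel lam n (x * t)) (μ.restrict (Ioi 0)) :=
    fun x hx => by
      rw [← hrr]
      exact hk.integrableOn_of_weightedPrimitive hlam hx (hW x hx)
  have hder : ∀ x, 0 < x → HasDerivAt (betaApprox lam a b μ n)
      (a * (lam * x ^ (lam - 1)) +
        c * (x ^ (lam - 1) * ∫ t in Ioi 0, betaKernel lam n (x * t) ∂μ)) x := fun x hx => by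
    have h1 := hk.hasDerivAt_integral_weightedPrimitive hlam hW hx
    rw [hrr] at h1
    have h2 := (((Real.hasDerivAt_rpow_const (p := lam) (Or.inl hx.ne')).const_mul a).add_const
      b).add (h1.const_mul c)
    refine h2.congr_of_eventuallyEq ?_
    filter_upwards [Ioi_mem_nhds hx] with y hy
    exact betaApprox_eq hlam a b μ hn hy
  have hnn : ∀ x, 0 < x → 0 ≤ betaApprox lam a b μ n x := fun x hx => by
    rw [betaApprox_eq hlam a b μ hn hx]
    have : 0 ≤ ∫ t in Ioi 0, weightedPrimitive lam (betaKernel lam n) (x * t) / t ^ lam ∂μ :=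
      setIntegral_nonneg measurableSet_Ioi fun t ht => hk.weightedPrimitive_div_nonneg hx ht
    positivity
  -- This `α` makes the Stieltjes order `lam + 1 - α` equal to the kernel exponent `n + lam`.
  refine ⟨1 - n, by linarith, isThorinBernstein_of_isGenStieltjes hlam (by linarith) hnn
    (fun x hx => (hder x hx).differentiableAt.differentiableWithinAt) ?_⟩
  rw [show lam + 1 - (1 - n) = (n : ℝ) + lam by ring]
  set w : ℝ → ENNReal := fun t => ENNReal.ofReal (c * (n / t) ^ (n + lam)) with hw
  have hwm : Measurable w := by fun_prop
  have hT : Measurable fun t : ℝ => (n : ℝ) / t := by fun_prop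
  -- Since the kernel at `xt` is `(n/t)^(n+lam) (n/t + x)^(-(n+lam))`, the Stieltjes measure is the
  -- image under `t ↦ n/t` of `μ` weighted by the first factor and `c`.
  set ρ : Measure ℝ := ((μ.restrict (Ioi 0)).withDensity w).map (fun t => (n : ℝ) / t) with hρ
  have hρr : ρ.restrict (Ici 0) = ρ := by
    refine Measure.restrict_eq_self_of_ae_mem ((ae_map_iff hT.aemeasurable measurableSet_Ici).2 ?_)
    filter_upwards [(withDensity_absolutelyContinuous _ w).ae_le hae] with t ht
    exact (div_pos hN ht).le
  have hwfin : ∀ᵐ t ∂μ.restrict (Ioi 0), w t < ⊤ :=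
    Eventually.of_forall fun t => ENNReal.ofReal_lt_top
  have hGm : ∀ x : ℝ, Measurable fun s : ℝ => 1 / (s + x) ^ ((n : ℝ) + lam) := fun x => by fun_prop
  have e : ∀ x, 0 < x → (fun t => c * betaKernel lam n (x * t)) =ᵐ[μ.restrict (Ioi 0)]
      fun t => (w t).toReal • (1 / (n / t + x) ^ ((n : ℝ) + lam)) := fun x hx => by
    filter_upwards [hae] with t ht
    rw [hw, ENNReal.toReal_ofReal (by positivity), betaKernel_eq_div hn hx ht, smul_eq_mul]
    ring
  refine ⟨a * lam, ρ, by positivity, ?_, fun x hx => ?_⟩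
  · rw [IntegrableOn, hρr, hρ]
    simp_rw [add_comm (1 : ℝ)]
    rw [integrable_map_measure (hGm 1).aestronglyMeasurable hT.aemeasurable,
      integrable_withDensity_iff_integrable_smul' hwm hwfin]
    exact ((hK 1 one_pos).const_mul c).congr (e 1 one_pos)
  · simp only
    rw [hρr, hρ, integral_map hT.aemeasurable (hGm x).aestronglyMeasurable,
      integral_withDensity_eq_integral_toReal_smul hwm hwfin, ← integral_congr_ae (e x hx),
      integral_const_mul, (hder x hx).deriv]
    have : x ^ (1 - lam) * x ^ (lam - 1) = 1 := by
      rw [← Real.rpow_add hx]; simp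
    linear_combination (a * lam + c * ∫ t in Ioi 0, betaKernel lam n (x * t) ∂μ) * this

end

theorem mainTheorem10 (lam : ℝ) (hlam : 0 < lam) :
    (∀ α : ℝ, α < lam + 1 → ∀ f : ℝ → ℝ, (∀ x : ℝ, 0 < x → 0 ≤ f x) →
      (IsThorinBernstein lam α f ↔
        DifferentiableOn ℝ f (Ioi 0) ∧
          IsGenStieltjes (lam + 1 - α) (fun x => x ^ (1 - lam) * deriv f x))) ∧
    (∀ f : ℝ → ℝ, IsGenBernstein lam f →
      (∃ (a b : ℝ) (μ : Measure ℝ), CorrespondsToTriple lam a b μ f) ∧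
      (∀ (a b : ℝ) (μ : Measure ℝ), CorrespondsToTriple lam a b μ f →
        (∀ n : ℕ, 1 ≤ n →
          (∀ x : ℝ, 0 < x → IntegrableOn (betaIntegrand lam n x) (Ioi 0) μ) ∧
          ∃ α : ℝ, α < lam + 1 ∧ IsThorinBernstein lam α (betaApprox lam a b μ n)) ∧
        (∀ x : ℝ, 0 < x →
          Tendsto (fun n : ℕ => betaApprox lam a b μ n x) atTop (𝓝 (f x))))) := by
  refine ⟨fun α hα f hf0 => ⟨fun h => h.isGenStieltjes hlam hα, fun h =>
    isThorinBernstein_of_isGenStieltjes hlam hα hf0 h.1 h.2⟩, fun f hf =>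
    ⟨hf.exists_triple hlam, fun a b μ h => ⟨fun n hn =>
      ⟨fun x hx => integrableOn_betaIntegrand hlam h.2.2.1 hn hx,
        exists_isThorinBernstein_betaApprox hlam h.1 h.2.1 h.2.2.1 hn⟩,
      fun x hx => tendsto_betaApprox hlam h hx⟩⟩⟩
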